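/- **Setting.** Write $X(r,\theta)=(r\cos\theta,r\sin\theta)$. Let $\theta_0\in\mathbb R$, $r_*>0$, and let $r_1,r_2:[\theta_0,\infty)\to(0,\infty)$ be continuous functions with $$r_2(\theta+2\pi)<r_1(\theta)<r_2(\theta)\ \text{ for all }\theta\ge\theta_0,\qquad \lim_{\theta\to\infty}r_1(\theta)=\lim_{\theta\to\infty}r_2(\theta)=r_*.$$ Let $\bar R$ be a number with $r_2(\theta)\le\bar R$ for all $\theta\ge\theta_0$. Put $$U=\{X(r,\theta):\theta>\theta_0,\ r_1(\theta)<r<r_2(\theta)\},\qquad \widetilde U=\{X(r,\theta):\theta\ge\theta_0,\ r_1(\theta)\le r\le r_2(\theta)\},$$ $$\gamma=\{X(r_i(\theta),\theta):\theta\ge\theta_0,\ i=1,2\},\qquad \mathcal S_{\theta_0}=\{X(r,\theta_0): r_1(\theta_0)\le r\le r_2(\theta_0)\}.$$ Assume that $r_1,r_2$ are absolutely continuous on $[\theta_0,\infty)$ and that $r_1',r_2'\in L^\infty(\Theta,\infty)$ for a number $\Theta\ge\theta_0$, and set $$\mu_0=\max\{\|r_1'\|_{L^\infty(\Theta,\infty)},\|r_2'\|_{L^\infty(\Theta,\infty)}\},\qquad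 k_*=\frac{\bar R+\mu_0}{r_*}.$$ For $\lambda\in[0,1]$ and $\theta\ge\theta_0$ let $X_\lambda(\theta)=X\big((1-\lambda)r_1(\theta)+\lambda r_2(\theta),\theta\big)$ and $s_\lambda(\theta)=\int_{\theta_0}^{\theta}|X_\lambda'(\eta)|\,d\eta$. Every $x\in\widetilde U$ equals $X_\lambda(\theta)$ for a unique $(\lambda,\theta)\in[0,1]\times[\theta_0,\infty)$; its *arc-distance* is $\mathscr L(x)=s_\lambda(\theta)$. For $J\subset[0,\infty)$ let $\widehat U_J=\{x\in\widetilde U:\mathscr L(x)\in J\}$. Let $Lu=-\sum_{i,j=1}^2a_{ij}\,\partial^2u/\partial x_i\partial x_j+b\cdot\nabla u$ in $U$, where $A=(a_{ij})$ is a function from $U$ to the real symmetric $2\times2$ matrices and $b:U\to\mathbb R^2$, and assume that there are constants $c_0,M_1>0$ and $M_2\ge0$ such that, for all $x\in U$ and $\xi\in\mathbb R^2$, $$\xi^{\rm T}A(x)\xi\ge c_0|\xi|^2,\qquad \operatorname{Tr}A(x)\le M_1,\qquad |b(x)|\le M_2 .$$ **Statement.** There are numbers $C_*'>0$ and $\nu'>0$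 such that the following holds for every $u\in C^2(U)\cap C(\widetilde U)$. (i) If $Lu\le0$ in $U$ and $u\le0$ on $\gamma$, then one of the following holds, where $u^+=\max\{u,0\}$. (a) For all $x\in\widetilde U$, $$u^+(x)\le\max_{\mathcal S_{\theta_0}}u^+\qquad\text{and}\qquad u^+(x)\le C_*'\Big(\max_{\mathcal S_{\theta_0}}u^+\Big)e^{-\nu'\mathscr L(x)}.$$ (b) There is $C_1'>0$ such that for every $\varepsilon>0$ there is $\bar\ell_1\ge0$ such that for all $\ell\ge\bar\ell_1$ $$\sup\big\{u^+(x):x\in\widehat U_{[(k_*+\varepsilon)^{-1}\ell,\,(k_*+\varepsilon)\ell]}\big\}\ge C_1'e^{\nu'\ell}.$$ (ii) If $Lu=0$ in $U$ and $u=0$ on $\gamma$, then one of the following holds. (a) For all $x\in\widetilde U$, $$|u(x)|\le\max_{\mathcal S_{\theta_0}}|u|\qquad\text{and}\qquad |u(x)|\le C_*'\Big(\max_{\mathcal S_{\theta_0}}|u|\Big)e^{-\nu'\mathscr L(x)}.$$ (b) There is $C'>0$ such that for every $\varepsilon>0$ there is $\bar\ell\ge0$ such that for all $\ell\ge\bar\ell$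 $$\sup\big\{|u(x)|:x\in\widehat U_{[(k_*+\varepsilon)^{-1}\ell,\,(k_*+\varepsilon)\ell]}\big\}\ge C'e^{\nu'\ell}.$$ -/

import Mathlib

open Set Filter Topology MeasureTheory

noncomputable section

namespace Spiral

/-- The Euclidean plane. -/
abbrev Plane : Type := EuclideanSpace ℝ (Fin 2)

/-- Polar coordinates `X(r, θ) = (r cos θ, r sin θ)`. -/
def polar (r θ : ℝ) : Plane := !₂[r * Real.cos θ, r * Real.sin θ]

/-- The open spiral domain `U`: points `X(r, θ)` with `θ > θ₀` and `r₁(θ) < r < r₂(θ)`. -/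
def domain (θ₀ : ℝ) (r₁ r₂ : ℝ → ℝ) : Set Plane :=
  {x | ∃ r θ : ℝ, θ₀ < θ ∧ r₁ θ < r ∧ r < r₂ θ ∧ x = polar r θ}

/-- The set `Ũ`: points `X(r, θ)` with `θ ≥ θ₀` and `r₁(θ) ≤ r ≤ r₂(θ)`. -/
def domainTilde (θ₀ : ℝ) (r₁ r₂ : ℝ → ℝ) : Set Plane :=
  {x | ∃ r θ : ℝ, θ₀ ≤ θ ∧ r₁ θ ≤ r ∧ r ≤ r₂ θ ∧ x = polar r θ}

/-- The curve `{X(ρ(θ), θ) : θ ≥ θ₀}`. -/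
def boundaryCurve (θ₀ : ℝ) (ρ : ℝ → ℝ) : Set Plane :=
  {x | ∃ θ : ℝ, θ₀ ≤ θ ∧ x = polar (ρ θ) θ}

/-- The lateral boundary `γ = γ₁ ∪ γ₂`. -/
def lateralBoundary (θ₀ : ℝ) (r₁ r₂ : ℝ → ℝ) : Set Plane :=
  boundaryCurve θ₀ r₁ ∪ boundaryCurve θ₀ r₂

/-- The cross-section `S_θ`. -/
def crossSection (r₁ r₂ : ℝ → ℝ) (θ : ℝ) : Set Plane :=
  {x | ∃ r : ℝ, r₁ θ ≤ r ∧ r ≤ r₂ θ ∧ x = polar r θ}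

/-- `R_lam = (1 - lam) r₁ + lam r₂`. -/
def radius (r₁ r₂ : ℝ → ℝ) (lam θ : ℝ) : ℝ := (1 - lam) * r₁ θ + lam * r₂ θ

/-- The curve `X_lam(θ) = X(R_lam(θ), θ)`. -/
def curve (r₁ r₂ : ℝ → ℝ) (lam θ : ℝ) : Plane := polar (radius r₁ r₂ lam θ) θ

/-- The arc-length `s_lam(θ)` of the curve `X_lam([θ₀, θ])`. -/
def arcLength (θ₀ : ℝ) (r₁ r₂ : ℝ → ℝ) (lam θ : ℝ) : ℝ :=
  ∫ η in θ₀..θ, ‖deriv (curve r₁ r₂ lam) η‖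

/-- The pair `p = (lam, θ)` lies in `[0, 1] × [θ₀, ∞)` and satisfies `x = X_lam(θ)`. -/
def IsCoord (θ₀ : ℝ) (r₁ r₂ : ℝ → ℝ) (x : Plane) (p : ℝ × ℝ) : Prop :=
  0 ≤ p.1 ∧ p.1 ≤ 1 ∧ θ₀ ≤ p.2 ∧ x = curve r₁ r₂ p.1 p.2

/-- Well-definedness of the curvilinear coordinates: each point of `Ũ` is `X_lam(θ)` for a unique
pair `(lam, θ)` in `[0, 1] × [θ₀, ∞)`, as soon as the spiral does not intersect itself. -/
theorem existsUnique_isCoord {θ₀ : ℝ} {r₁ r₂ : ℝ → ℝ}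
    (hpos : ∀ θ, θ₀ ≤ θ → 0 < r₁ θ)
    (hspiral : ∀ θ, θ₀ ≤ θ → r₂ (θ + 2 * Real.pi) < r₁ θ ∧ r₁ θ < r₂ θ)
    {x : Plane} (hx : x ∈ domainTilde θ₀ r₁ r₂) : ∃! p, IsCoord θ₀ r₁ r₂ x p := by
  have hpi := Real.pi_pos
  -- radii strictly decrease from one turn to any later one
  have hturn : ∀ θ, θ₀ ≤ θ → ∀ k : ℕ, r₂ (θ + (k + 1) * (2 * Real.pi)) < r₁ θ := by
    intro θ hθ k
    induction k with
    | zero => simpa using (hspiral θ hθ).1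
    | succ k ih =>
      have h0 : θ₀ ≤ θ + (k + 1) * (2 * Real.pi) := by
        have : 0 ≤ ((k : ℝ) + 1) * (2 * Real.pi) := by positivity
        linarith
      have h1 := hspiral _ h0
      push_cast
      have e : θ + ((k : ℝ) + 1 + 1) * (2 * Real.pi)
          = θ + (k + 1) * (2 * Real.pi) + 2 * Real.pi := by ring
      rw [e]; linarith
  have hrad : ∀ lam θ, 0 ≤ lam → lam ≤ 1 → θ₀ ≤ θ →
      r₁ θ ≤ radius r₁ r₂ lam θ ∧ radius r₁ r₂ lam θ ≤ r₂ θ := by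
    intro lam θ h0 h1 hθ
    have := (hspiral θ hθ).2
    unfold radius
    constructor <;> nlinarith
  have hpol : ∀ r r' θ θ', 0 < r → 0 < r' → polar r θ = polar r' θ' →
      r = r' ∧ ∃ k : ℤ, θ = θ' + k * (2 * Real.pi) := by
    intro r r' θ θ' hr hr' h
    have hc : r * Real.cos θ = r' * Real.cos θ' := by
      simpa [polar] using congrArg (fun v : Plane => v 0) h
    have hs : r * Real.sin θ = r' * Real.sin θ' := by
      simpa [polar] using congrArg (fun v : Plane => v 1) h
    have hrr : r = r' := by
      have h2 : r ^ 2 = r' ^ 2 := by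
        have e1 := Real.sin_sq_add_cos_sq θ
        have e2 := Real.sin_sq_add_cos_sq θ'
        calc r ^ 2 = (r * Real.sin θ) ^ 2 + (r * Real.cos θ) ^ 2 := by
              rw [mul_pow, mul_pow, ← mul_add, e1, mul_one]
          _ = r' ^ 2 := by rw [hc, hs, mul_pow, mul_pow, ← mul_add, e2, mul_one]
      exact (pow_left_inj₀ hr.le hr'.le two_ne_zero).1 h2
    subst hrr
    refine ⟨rfl, ?_⟩
    have ha : (θ : Real.Angle) = (θ' : Real.Angle) :=
      Real.Angle.cos_sin_inj (mul_left_cancel₀ hr.ne' hc) (mul_left_cancel₀ hr.ne' hs)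
    obtain ⟨k, hk⟩ := Real.Angle.angle_eq_iff_two_pi_dvd_sub.1 ha
    exact ⟨k, by linarith⟩
  have hno : ∀ lam lam' θ θ', 0 ≤ lam → lam ≤ 1 → 0 ≤ lam' → lam' ≤ 1 → θ₀ ≤ θ → θ₀ ≤ θ' →
      radius r₁ r₂ lam θ = radius r₁ r₂ lam' θ' → ∀ k : ℤ, θ = θ' + k * (2 * Real.pi) → k ≤ 0 := by
    intro lam lam' θ θ' h1 h2 h3 h4 h5 h6 hR k hk
    by_contra! hpos
    obtain ⟨n, rfl⟩ : ∃ n : ℕ, k = n + 1 := ⟨(k - 1).toNat, by omega⟩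
    have a := hturn θ' h6 n
    push_cast at hk
    rw [← hk] at a
    have b := (hrad lam θ h1 h2 h5).2
    have c := (hrad lam' θ' h3 h4 h6).1
    linarith
  obtain ⟨r, θ, hθ, h1, h2, rfl⟩ := hx
  have h12 := (hspiral θ hθ).2
  have hd : 0 < r₂ θ - r₁ θ := by linarith
  refine ⟨((r - r₁ θ) / (r₂ θ - r₁ θ), θ), ⟨?_, ?_, hθ, ?_⟩, ?_⟩
  · exact div_nonneg (by linarith) hd.le
  · exact (div_le_one hd).2 (by linarith)
  · have : radius r₁ r₂ ((r - r₁ θ) / (r₂ θ - r₁ θ)) θ = r := by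
      unfold radius; field_simp; ring
    simp only [curve, this]
  · rintro ⟨lam, θ'⟩ ⟨g0, g1, gθ, gx⟩
    simp only at g0 g1 gθ gx
    set mu := (r - r₁ θ) / (r₂ θ - r₁ θ) with hmu
    have m0 : 0 ≤ mu := div_nonneg (by linarith) hd.le
    have m1 : mu ≤ 1 := (div_le_one hd).2 (by linarith)
    have hr : radius r₁ r₂ mu θ = r := by
      rw [hmu]; unfold radius; field_simp; ring
    have hrpos : 0 < r := (hpos θ hθ).trans_le h1
    have hr'pos : 0 < radius r₁ r₂ lam θ' := (hpos θ' gθ).trans_le (hrad lam θ' g0 g1 gθ).1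
    obtain ⟨e1, k, hk⟩ := hpol _ _ _ _ hrpos hr'pos gx
    have k1 := hno mu lam θ θ' m0 m1 g0 g1 hθ gθ (by rw [hr, e1]) k hk
    have k2 := hno lam mu θ' θ g0 g1 m0 m1 gθ hθ (by rw [hr, e1]) (-k)
      (by push_cast; linarith)
    obtain rfl : k = 0 := by omega
    have ht : θ' = θ := by simp at hk; exact hk.symm
    subst ht
    have : lam = mu := by
      rw [← hr] at e1
      unfold radius at e1
      have : (lam - mu) * (r₂ θ' - r₁ θ') = 0 := by linarith
      rcases mul_eq_zero.1 this with h | h <;> linarith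
    rw [this]

open Classical in
/-- The arc-distance `ℒ(x) = s_lam(θ)` where `(lam, θ)` is the pair in `[0, 1] × [θ₀, ∞)` such that
`x = X_lam(θ)`; it is unique for `x` in `Ũ`. Off `Ũ` the value is irrelevant and set to `0`. -/
def arcDist (θ₀ : ℝ) (r₁ r₂ : ℝ → ℝ) (x : Plane) : ℝ :=
  if h : ∃ p, IsCoord θ₀ r₁ r₂ x p then
    arcLength θ₀ r₁ r₂ h.choose.1 h.choose.2
  else 0

/-- The set `Û_J = {x ∈ Ũ : ℒ(x) ∈ J}`. -/
def arcBand (θ₀ : ℝ) (r₁ r₂ : ℝ → ℝ) (J : Set ℝ) : Set Plane :=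
  {x | x ∈ domainTilde θ₀ r₁ r₂ ∧ arcDist θ₀ r₁ r₂ x ∈ J}

/-- The norm of the a.e. derivative of `ρ` in `L^∞(Θ, ∞)`. -/
def derivSupNorm (ρ : ℝ → ℝ) (Θ : ℝ) : ℝ :=
  (eLpNorm (deriv ρ) ⊤ (volume.restrict (Ioi Θ))).toReal

/-- `μ₀`, the larger of the `L^∞(Θ, ∞)` norms of `r₁'` and `r₂'`. -/
def mu0 (r₁ r₂ : ℝ → ℝ) (Θ : ℝ) : ℝ := max (derivSupNorm r₁ Θ) (derivSupNorm r₂ Θ)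

/-- `k_* = (R̄ + μ₀) / r_*`. -/
def kStar (r₁ r₂ : ℝ → ℝ) (rs Rbar Θ : ℝ) : ℝ := (Rbar + mu0 r₁ r₂ Θ) / rs

/-- `∂²u / ∂x_i ∂x_j` at `x`. -/
def secondPartial (u : Plane → ℝ) (i j : Fin 2) (x : Plane) : ℝ :=
  fderiv ℝ (fun y => fderiv ℝ u y (EuclideanSpace.single j 1)) x (EuclideanSpace.single i 1)

/-- The operator `Lu = -∑ a_ij ∂²u / ∂x_i ∂x_j + b · ∇u`. -/
def ellipticOp (A : Plane → Matrix (Fin 2) (Fin 2) ℝ) (b : Plane → Plane)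
    (u : Plane → ℝ) (x : Plane) : ℝ :=
  -(∑ i, ∑ j, A x i j * secondPartial u i j x) + inner ℝ (b x) (gradient u x)

/-- Absolute continuity on `[θ₀, ∞)` together with a derivative in `L^∞(Θ, ∞)`. Absolute continuity
is required on each compact interval; given the bound on the derivative this is the same as absolute
continuity on the whole half-line. -/
def RegularBoundary (θ₀ Θ : ℝ) (ρ : ℝ → ℝ) : Prop :=
  (∀ T, θ₀ ≤ T → AbsolutelyContinuousOnInterval ρ θ₀ T) ∧
    MemLp (deriv ρ) ⊤ (volume.restrict (Ioi Θ))

/-- Symmetric coefficients, uniformly elliptic with constant `c₀` and with trace at most `M₁`. -/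
def UniformlyElliptic (Ω : Set Plane) (A : Plane → Matrix (Fin 2) (Fin 2) ℝ) (c₀ M₁ : ℝ) : Prop :=
  ∀ x ∈ Ω, (A x).IsSymm ∧
    (∀ ξ : Plane, c₀ * ‖ξ‖ ^ 2 ≤ ∑ i, ∑ j, ξ i * A x i j * ξ j) ∧ (A x).trace ≤ M₁

end Spiral

end

noncomputable section

namespace Spiral

/-! Far out, the spiral winds inside a thin annulus just outside the circle of radius `rs`. With σ =
r² - rs², the Hessian of 1 - σ² contains the term -8 x xᵀ, which ellipticity turns into a gain of at
least 8 c₀ rs² in the operator. Let F be a positive combination of exp(νθ) and exp(-νθ). In the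
operator applied to F(θ)(1 - σ²), every term of unfavourable sign carries a factor ν as soon as σ ≤
ν, so for small ν this product is a strict supersolution (`isStrictBarrierAt_mul`).

Comparison on θ₁ ≤ θ ≤ T bounds a subsolution by 2 m₁ exp(-ν(θ - θ₁)) + 2 m₂ exp(ν(θ - T)), where m₁
and m₂ bound it on the two end sections (`IsSpiral.exists_decay`). If m₂ can be taken o(exp(νT))
along some sequence T → ∞, the second term disappears and u decays; the maximum principle on [θ₀, T]
with T → ∞ then bounds u by its values on the first section. If not, some multiple of exp(νT) is
reached on every section far enough out. Linear bounds between angle and arc-distance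
(`IsSpiral.arcDist_bounds`) convert rates in θ into rates in ℒ.

The angle is multivalued in the plane, so barriers are functions of (r, θ) and comparison takes
place in the parameter region (`IsSpiral.le_of_barrier`). A contact point is studied through a local
branch of the angle, along straight lines. -/

theorem polar_zero (r t : ℝ) : polar r t 0 = r * Real.cos t := by simp [polar]

theorem polar_one (r t : ℝ) : polar r t 1 = r * Real.sin t := by simp [polar]

theorem norm_sq_plane (x : Plane) : ‖x‖ ^ 2 = x 0 ^ 2 + x 1 ^ 2 := by
  simp [EuclideanSpace.norm_sq_eq]

theorem norm_polar {r : ℝ} (hr : 0 ≤ r) (t : ℝ) : ‖polar r t‖ = r := by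
  refine (pow_left_inj₀ (norm_nonneg _) hr two_ne_zero).1 ?_
  rw [norm_sq_plane, polar_zero, polar_one]
  linear_combination r ^ 2 * Real.cos_sq_add_sin_sq t

theorem continuous_polar : Continuous fun p : ℝ × ℝ => polar p.1 p.2 := by
  refine (PiLp.continuous_toLp 2 _).comp (continuous_pi fun i => ?_)
  fin_cases i <;> simp <;> fun_prop

/-! ### Rotated components and a local branch of the angle -/

/-- The component of `x` in the direction of angle `t`. -/
def radialPart (t : ℝ) (x : Plane) : ℝ := Real.cos t * x 0 + Real.sin t * x 1

/-- The component of `x` orthogonal to the direction of angle `t`. -/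
def angularPart (t : ℝ) (x : Plane) : ℝ := -Real.sin t * x 0 + Real.cos t * x 1

/-- The branch of the polar angle that takes the value `t` on the ray of angle `t`. -/
def localAngle (t : ℝ) (x : Plane) : ℝ := t + Real.arctan (angularPart t x / radialPart t x)

theorem radialPart_sq_add_angularPart_sq (t : ℝ) (x : Plane) :
    radialPart t x ^ 2 + angularPart t x ^ 2 = ‖x‖ ^ 2 := by
  rw [norm_sq_plane, radialPart, angularPart]
  linear_combination (x 0 ^ 2 + x 1 ^ 2) * Real.cos_sq_add_sin_sq t

theorem abs_radialPart_le (t : ℝ) (x : Plane) : |radialPart t x| ≤ ‖x‖ :=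
  abs_le_of_sq_le_sq (by nlinarith [radialPart_sq_add_angularPart_sq t x]) (norm_nonneg _)

theorem abs_angularPart_le (t : ℝ) (x : Plane) : |angularPart t x| ≤ ‖x‖ :=
  abs_le_of_sq_le_sq (by nlinarith [radialPart_sq_add_angularPart_sq t x]) (norm_nonneg _)

theorem radialPart_polar (r t : ℝ) : radialPart t (polar r t) = r := by
  rw [radialPart, polar_zero, polar_one]
  linear_combination r * Real.cos_sq_add_sin_sq t

theorem angularPart_polar (r t : ℝ) : angularPart t (polar r t) = 0 := by
  rw [angularPart, polar_zero, polar_one]; ring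

theorem localAngle_polar (r t : ℝ) : localAngle t (polar r t) = t := by
  simp [localAngle, angularPart_polar]

theorem radialPart_add_smul (t s : ℝ) (x ξ : Plane) :
    radialPart t (x + s • ξ) = radialPart t x + s * radialPart t ξ := by
  simp [radialPart]; ring

theorem angularPart_add_smul (t s : ℝ) (x ξ : Plane) :
    angularPart t (x + s • ξ) = angularPart t x + s * angularPart t ξ := by
  simp [angularPart]; ring

theorem continuous_radialPart (t : ℝ) : Continuous (radialPart t) := by
  unfold radialPart; fun_prop

theorem continuous_angularPart (t : ℝ) : Continuous (angularPart t) := by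
  unfold angularPart; fun_prop

/-- On the half-plane where the radial part p is positive, q / p is the tangent of the angle from
the ray, and the arctangent recovers that angle without ambiguity. -/
theorem polar_norm_localAngle {t : ℝ} {x : Plane} (hp : 0 < radialPart t x) :
    polar ‖x‖ (localAngle t x) = x := by
  set p := radialPart t x with hpdef
  set q := angularPart t x with hqdef
  have hn : ‖x‖ = p * √(1 + (q / p) ^ 2) := by
    refine (pow_left_inj₀ (norm_nonneg _) (by positivity) two_ne_zero).1 ?_
    rw [← radialPart_sq_add_angularPart_sq t x, mul_pow, Real.sq_sqrt (by positivity), ← hpdef,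
      ← hqdef]
    field_simp
  have hs : 0 < √(1 + (q / p) ^ 2) := by positivity
  have h0 : x 0 = Real.cos t * p - Real.sin t * q := by
    rw [hpdef, hqdef, radialPart, angularPart]
    linear_combination -x 0 * Real.cos_sq_add_sin_sq t
  have h1 : x 1 = Real.sin t * p + Real.cos t * q := by
    rw [hpdef, hqdef, radialPart, angularPart]
    linear_combination -x 1 * Real.cos_sq_add_sin_sq t
  ext i
  fin_cases i
  · simp only [Fin.zero_eta, Fin.isValue]
    rw [polar_zero, localAngle, Real.cos_add, Real.cos_arctan, Real.sin_arctan, ← hpdef, ← hqdef,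
      hn, h0]
    field_simp
  · simp only [Fin.mk_one, Fin.isValue]
    rw [polar_one, localAngle, Real.sin_add, Real.cos_arctan, Real.sin_arctan, ← hpdef, ← hqdef,
      hn, h1]
    field_simp

theorem continuousAt_localAngle {t : ℝ} {x : Plane} (hp : radialPart t x ≠ 0) :
    ContinuousAt (localAngle t) x :=
  continuousAt_const.add (Real.continuous_arctan.continuousAt.comp
    ((continuous_angularPart t).continuousAt.div (continuous_radialPart t).continuousAt hp))

/-- Points near `polar r t` have polar coordinates near `(r, t)`. -/
theorem eventually_polar_eq {r t : ℝ} (hr : 0 < r) :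
    ∀ᶠ x in 𝓝 (polar r t), polar ‖x‖ (localAngle t x) = x := by
  have h : ∀ᶠ x in 𝓝 (polar r t), 0 < radialPart t x :=
    (continuous_radialPart t).continuousAt.eventually_const_lt (by rwa [radialPart_polar])
  exact h.mono fun x hx => polar_norm_localAngle hx

theorem tendsto_norm_localAngle {r t : ℝ} (hr : 0 < r) :
    Tendsto (fun x => (‖x‖, localAngle t x)) (𝓝 (polar r t)) (𝓝 (r, t)) := by
  have h1 : Tendsto (fun x : Plane => ‖x‖) (𝓝 (polar r t)) (𝓝 r) := by
    simpa [norm_polar hr.le] using (continuous_norm (E := Plane)).tendsto (polar r t)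
  have h2 : Tendsto (localAngle t) (𝓝 (polar r t)) (𝓝 t) := by
    have := (continuousAt_localAngle (t := t) (x := polar r t)
      (by rw [radialPart_polar]; exact hr.ne')).tendsto
    rwa [localAngle_polar] at this
  exact h1.prodMk_nhds h2

theorem tendsto_add_smul (x ξ : Plane) : Tendsto (fun s : ℝ => x + s • ξ) (𝓝 0) (𝓝 x) := by
  have : ContinuousAt (fun s : ℝ => x + s • ξ) 0 := by fun_prop
  simpa [ContinuousAt] using this

/-- First and second derivatives of the angle along a line. -/
theorem hasDerivAt_localAngle_line {r t : ℝ} (hr : 0 < r) (ξ : Plane) :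
    (∀ᶠ s in 𝓝 (0 : ℝ), HasDerivAt (fun s => localAngle t (polar r t + s • ξ))
      (r * angularPart t ξ / ‖polar r t + s • ξ‖ ^ 2) s) ∧
    HasDerivAt (fun s : ℝ => r * angularPart t ξ / ‖polar r t + s • ξ‖ ^ 2)
      (-2 * radialPart t ξ * angularPart t ξ / r ^ 2) 0 := by
  set a := radialPart t ξ
  set c := angularPart t ξ
  have hn : ∀ s : ℝ, ‖polar r t + s • ξ‖ ^ 2 = (r + s * a) ^ 2 + (s * c) ^ 2 := fun s => by
    rw [← radialPart_sq_add_angularPart_sq t, radialPart_add_smul, angularPart_add_smul,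
      radialPart_polar, angularPart_polar, zero_add]
  have hpos : ∀ᶠ s in 𝓝 (0 : ℝ), 0 < r + s * a := by
    have : ContinuousAt (fun s : ℝ => r + s * a) 0 := by fun_prop
    exact this.eventually_const_lt (by simpa using hr)
  constructor
  · filter_upwards [hpos] with s hs
    -- The quotient rule leaves the constant numerator r * c: it is the cross product of position
    -- and direction, which does not change along the line.
    have hl : (fun s => localAngle t (polar r t + s • ξ))
        = fun s => t + Real.arctan ((s * c) / (r + s * a)) := by
      funext s
      rw [localAngle, radialPart_add_smul, angularPart_add_smul, radialPart_polar,
        angularPart_polar, zero_add]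
    have h1 : HasDerivAt (fun s : ℝ => s * c) c s := by simpa using (hasDerivAt_id s).mul_const c
    have h2 : HasDerivAt (fun s : ℝ => r + s * a) a s := by
      simpa using ((hasDerivAt_id s).mul_const a).const_add r
    rw [hl, hn]
    convert! ((h1.fun_div h2 hs.ne').arctan).const_add t using 1
    have : 0 < (r + s * a) ^ 2 + (s * c) ^ 2 := by positivity
    field_simp
    ring
  · simp only [hn]
    have h1 : HasDerivAt (fun s : ℝ => (r + s * a) ^ 2 + (s * c) ^ 2) (2 * r * a) 0 := by
      have h2 : HasDerivAt (fun s : ℝ => r + s * a) a 0 := by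
        simpa using ((hasDerivAt_id (0 : ℝ)).mul_const a).const_add r
      have h3 : HasDerivAt (fun s : ℝ => s * c) c 0 := by
        simpa using (hasDerivAt_id (0 : ℝ)).mul_const c
      exact ((h2.fun_pow 2).fun_add (h3.fun_pow 2)).congr_deriv (by simp)
    refine ((hasDerivAt_const (0 : ℝ) (r * c)).fun_div h1 (by simp [hr.ne'])).congr_deriv ?_
    simp
    field_simp

/-! ### Touching from above: directional bounds and the operator -/

/-- The second derivative test at a local maximum. -/
theorem second_deriv_nonpos_of_isLocalMax {f f' : ℝ → ℝ} {f'' x : ℝ} (hmax : IsLocalMax f x)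
    (hf : ∀ᶠ s in 𝓝 x, HasDerivAt f (f' s) s) (hf' : HasDerivAt f' f'' x) :
    f' x = 0 ∧ f'' ≤ 0 := by
  have h0 : f' x = 0 := hmax.hasDerivAt_eq_zero hf.self_of_nhds
  refine ⟨h0, ?_⟩
  -- A positive second derivative would make the point a local minimum too, so `f` would be constant
  -- nearby and `f''` would vanish.
  by_contra! hlt
  have hd : deriv f =ᶠ[𝓝 x] f' := hf.mono fun s hs => hs.deriv
  have hmin : IsLocalMin f x := by
    apply isLocalMin_of_deriv_deriv_pos
    · rw [hd.deriv_eq, hf'.deriv]; exact hlt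
    · rw [hd.self_of_nhds, h0]
    · exact hf.self_of_nhds.continuousAt
  have hc : f =ᶠ[𝓝 x] fun _ => f x := by
    filter_upwards [hmin, hmax] with s h1 h2 using le_antisymm h2 h1
  have hz : f' =ᶠ[𝓝 x] fun _ => 0 := by
    filter_upwards [hd, hc.deriv] with s h1 h2
    rw [← h1, h2, deriv_const]
  have := (hf'.congr_of_eventuallyEq hz.symm).unique (hasDerivAt_const x (0 : ℝ))
  exact hlt.ne' this

/-- If `g` touches a `C²` function `u` from above along a line, the derivatives of `u` and `g`
along that line compare. -/
theorem fderiv_compare_of_touch {u : Plane → ℝ} {x ξ : Plane} (hu : ContDiffAt ℝ 2 u x)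
    {g g' : ℝ → ℝ} {g'' : ℝ} (hg : ∀ᶠ s in 𝓝 (0 : ℝ), HasDerivAt g (g' s) s)
    (hg' : HasDerivAt g' g'' 0)
    (hmax : IsLocalMax (fun s : ℝ => u (x + s • ξ) - g s) 0) :
    fderiv ℝ u x ξ = g' 0 ∧ fderiv ℝ (fderiv ℝ u) x ξ ξ ≤ g'' := by
  have hl : ∀ s : ℝ, HasDerivAt (fun s : ℝ => x + s • ξ) ξ s := fun s => by
    simpa using ((hasDerivAt_id s).smul_const ξ).const_add x
  have hu1 : ∀ᶠ y in 𝓝 x, DifferentiableAt ℝ u y := by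
    filter_upwards [hu.eventually (by simp)] with y hy using hy.differentiableAt (by simp)
  have hu2 : DifferentiableAt ℝ (fderiv ℝ u) x :=
    (hu.fderiv_right (m := 1) (by norm_num)).differentiableAt (by simp)
  have e1 : ∀ᶠ s in 𝓝 (0 : ℝ),
      HasDerivAt (fun s : ℝ => u (x + s • ξ)) (fderiv ℝ u (x + s • ξ) ξ) s := by
    filter_upwards [(tendsto_add_smul x ξ).eventually hu1] with s hs
    exact hs.hasFDerivAt.comp_hasDerivAt s (hl s)
  have e2 : HasDerivAt (fun s : ℝ => fderiv ℝ u (x + s • ξ) ξ)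
      (fderiv ℝ (fderiv ℝ u) x ξ ξ) 0 := by
    have h3 : HasFDerivAt (fderiv ℝ u) (fderiv ℝ (fderiv ℝ u) x) (x + (0 : ℝ) • ξ) := by
      simpa using hu2.hasFDerivAt
    have h4 := h3.comp_hasDerivAt (0 : ℝ) (hl 0)
    exact h4.clm_apply (hasDerivAt_const (0 : ℝ) ξ) |>.congr_deriv (by simp)
  obtain ⟨h1, h2⟩ := second_deriv_nonpos_of_isLocalMax hmax
    (by filter_upwards [e1, hg] with s a b using a.sub b) (e2.sub hg')
  constructor
  · simpa [sub_eq_zero] using h1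
  · linarith

/-- Pairing a positive definite matrix with two ordered quadratic forms in two variables. -/
theorem pairing_le_of_forall_le {a b c q₀ q₁ q₂ p₀ p₁ p₂ : ℝ} (ha : 0 < a)
    (hdet : b ^ 2 ≤ a * c)
    (h : ∀ s t : ℝ, p₀ * s ^ 2 + p₁ * (s * t) + p₂ * t ^ 2
      ≤ q₀ * s ^ 2 + q₁ * (s * t) + q₂ * t ^ 2) :
    a * p₀ + b * p₁ + c * p₂ ≤ a * q₀ + b * q₁ + c * q₂ := by
  -- The matrix with rows (a, b) and (b, c) is a times the square of (1, b/a) plus (c - b²/a) times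
  -- the square of (0, 1), with nonnegative weights; testing these two directions is enough.
  have h1 := h 1 (b / a)
  have h2 := h 0 1
  have h3 : 0 ≤ c - b ^ 2 / a := by
    rw [sub_nonneg, div_le_iff₀ ha]; linarith
  have h4 := mul_le_mul_of_nonneg_left h1 ha.le
  have h5 := mul_le_mul_of_nonneg_left h2 h3
  have e : ∀ x y z : ℝ, a * x + b * y + c * z = a * (x * 1 ^ 2 + y * (1 * (b / a))
      + z * (b / a) ^ 2) + (c - b ^ 2 / a) * (x * 0 ^ 2 + y * (0 * 1) + z * 1 ^ 2) := by
    intro x y z; field_simp; ring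
  rw [e, e]
  exact add_le_add h4 h5

/-- The operator expressed through the second Fréchet derivative. -/
theorem ellipticOp_eq {A : Plane → Matrix (Fin 2) (Fin 2) ℝ} {b : Plane → Plane}
    {u : Plane → ℝ} {x : Plane} (hu : ContDiffAt ℝ 2 u x) :
    ellipticOp A b u x = -(∑ i, ∑ j, A x i j *
      fderiv ℝ (fderiv ℝ u) x (EuclideanSpace.single i 1) (EuclideanSpace.single j 1))
      + fderiv ℝ u x (b x) := by
  have hu2 : DifferentiableAt ℝ (fderiv ℝ u) x :=
    (hu.fderiv_right (m := 1) (by norm_num)).differentiableAt (by simp)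
  have h1 : ∀ i j, secondPartial u i j x
      = fderiv ℝ (fderiv ℝ u) x (EuclideanSpace.single i 1) (EuclideanSpace.single j 1) := by
    intro i j
    rw [secondPartial, fderiv_clm_apply hu2 (by fun_prop)]
    simp
  have h2 : inner ℝ (b x) (gradient u x) = fderiv ℝ u x (b x) := by
    rw [real_inner_comm, gradient, InnerProductSpace.toDual_symm_apply]
  simp only [ellipticOp, h1, h2]

/-- A lower bound for the operator from directional bounds on the second derivative. -/
theorem le_ellipticOp_of_forall {A : Plane → Matrix (Fin 2) (Fin 2) ℝ} {b : Plane → Plane}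
    {u : Plane → ℝ} {x : Plane} (hu : ContDiffAt ℝ 2 u x) (hs : (A x).IsSymm)
    {c₀ : ℝ} (hc₀ : 0 < c₀)
    (hA : ∀ ξ : Plane, c₀ * ‖ξ‖ ^ 2 ≤ ∑ i, ∑ j, ξ i * A x i j * ξ j)
    {α β : ℝ} {v : Plane}
    (h : ∀ ξ : Plane, fderiv ℝ (fderiv ℝ u) x ξ ξ
      ≤ α * ‖ξ‖ ^ 2 - β * (v 0 * ξ 0 + v 1 * ξ 1) ^ 2) :
    -(α * (A x).trace - β * ∑ i, ∑ j, v i * A x i j * v j) + fderiv ℝ u x (b x)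
      ≤ ellipticOp A b u x := by
  rw [ellipticOp_eq hu]
  have hsym : A x 1 0 = A x 0 1 := hs.apply 0 1
  have hq : ∀ s t : ℝ, c₀ * (s ^ 2 + t ^ 2)
      ≤ A x 0 0 * s ^ 2 + 2 * A x 0 1 * (s * t) + A x 1 1 * t ^ 2 := fun s t => by
    have := hA !₂[s, t]
    rw [norm_sq_plane] at this
    simp [Fin.sum_univ_two, hsym] at this
    linarith
  have ha : 0 < A x 0 0 := by have := hq 1 0; norm_num at this; linarith
  have hdet : A x 0 1 ^ 2 ≤ A x 0 0 * A x 1 1 := by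
    -- On this vector the quadratic form equals `A x 0 0` times the determinant.
    have h1 := hq (A x 0 1) (-A x 0 0)
    have h2 : 0 ≤ c₀ * (A x 0 1 ^ 2 + (-A x 0 0) ^ 2) := by positivity
    have h3 : 0 ≤ A x 0 0 * (A x 0 0 * A x 1 1 - A x 0 1 ^ 2) := by nlinarith
    have := nonneg_of_mul_nonneg_right h3 ha
    linarith
  set B := fderiv ℝ (fderiv ℝ u) x with hB
  set e₀ : Plane := EuclideanSpace.single 0 1 with he₀
  set e₁ : Plane := EuclideanSpace.single 1 1 with he₁
  -- The mixed coefficient is the sum of both mixed derivatives, so their equality is not needed.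
  have key := pairing_le_of_forall_le (p₀ := B e₀ e₀) (p₁ := B e₀ e₁ + B e₁ e₀) (p₂ := B e₁ e₁)
    (q₀ := α - β * v 0 ^ 2) (q₁ := -2 * β * (v 0 * v 1)) (q₂ := α - β * v 1 ^ 2) ha hdet
    (fun s t => by
      have h1 := h (s • e₀ + t • e₁)
      rw [norm_sq_plane] at h1
      simp [he₀, he₁] at h1
      simp only [he₀, he₁]
      nlinarith)
  rw [Matrix.trace]
  simp only [Fin.sum_univ_two, Matrix.diag, hsym, ← he₀, ← he₁]
  nlinarith

end Spiral

namespace Spiral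

/-- The hypotheses on the radii of the spiral. -/
structure IsSpiral (θ₀ : ℝ) (r₁ r₂ : ℝ → ℝ) (rs Rbar : ℝ) : Prop where
  cont₁ : ContinuousOn r₁ (Ici θ₀)
  cont₂ : ContinuousOn r₂ (Ici θ₀)
  nested : ∀ θ, θ₀ ≤ θ → r₂ (θ + 2 * Real.pi) < r₁ θ ∧ r₁ θ < r₂ θ
  rs_pos : 0 < rs
  lim₁ : Tendsto r₁ atTop (𝓝 rs)
  lim₂ : Tendsto r₂ atTop (𝓝 rs)
  bound : ∀ θ, θ₀ ≤ θ → r₂ θ ≤ Rbar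

/-- The function `(r, t) ↦ V r t` touches no `C²` subsolution from above at `(r, t)`. -/
def IsStrictBarrierAt (A : Plane → Matrix (Fin 2) (Fin 2) ℝ) (b : Plane → Plane)
    (V : ℝ → ℝ → ℝ) (r t : ℝ) : Prop :=
  ∀ u : Plane → ℝ, ContDiffAt ℝ 2 u (polar r t) →
    IsLocalMax (fun x => u x - V ‖x‖ (localAngle t x)) (polar r t) →
    0 < ellipticOp A b u (polar r t)

/-! ### Comparison with barriers on the spiral -/

section Geometry

variable {θ₀ : ℝ} {r₁ r₂ : ℝ → ℝ} {rs Rbar : ℝ}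

/-- Nesting makes `r₁` decrease from each turn to the next, and along θ + 2πn it tends to `rs`. -/
theorem IsSpiral.rs_le (h : IsSpiral θ₀ r₁ r₂ rs Rbar) {θ : ℝ} (hθ : θ₀ ≤ θ) : rs ≤ r₁ θ := by
  have hpi := Real.pi_pos
  have hmem : ∀ n : ℕ, θ₀ ≤ θ + n * (2 * Real.pi) := fun n => by
    have : 0 ≤ (n : ℝ) * (2 * Real.pi) := by positivity
    linarith
  have hle : ∀ n : ℕ, r₁ (θ + n * (2 * Real.pi)) ≤ r₁ θ := by
    intro n
    induction n with
    | zero => simp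
    | succ n ih =>
      have h1 := (h.nested _ (hmem n)).1
      have h2 := (h.nested _ (hmem (n + 1))).2
      have e : θ + ((n + 1 : ℕ) : ℝ) * (2 * Real.pi)
          = θ + n * (2 * Real.pi) + 2 * Real.pi := by push_cast; ring
      rw [e] at h2 ⊢
      linarith
  have ht : Tendsto (fun n : ℕ => θ + n * (2 * Real.pi)) atTop atTop :=
    tendsto_atTop_add_const_left _ _
      (tendsto_natCast_atTop_atTop.atTop_mul_const (by positivity))
  exact le_of_tendsto' (h.lim₁.comp ht) hle

theorem IsSpiral.lt (h : IsSpiral θ₀ r₁ r₂ rs Rbar) {θ : ℝ} (hθ : θ₀ ≤ θ) : r₁ θ < r₂ θ :=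
  (h.nested θ hθ).2

theorem IsSpiral.rs_le_Rbar (h : IsSpiral θ₀ r₁ r₂ rs Rbar) : rs ≤ Rbar :=
  (h.rs_le le_rfl).trans ((h.lt le_rfl).le.trans (h.bound _ le_rfl))

theorem IsSpiral.radius_mem (h : IsSpiral θ₀ r₁ r₂ rs Rbar) {lam θ : ℝ} (h0 : 0 ≤ lam)
    (h1 : lam ≤ 1) (hθ : θ₀ ≤ θ) :
    r₁ θ ≤ radius r₁ r₂ lam θ ∧ radius r₁ r₂ lam θ ≤ r₂ θ := by
  have := h.lt hθ
  unfold radius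
  constructor <;> nlinarith

/-- The part of the parameter region over a compact interval of angles is compact. -/
theorem IsSpiral.isCompact_region (h : IsSpiral θ₀ r₁ r₂ rs Rbar) {a T : ℝ} (ha : θ₀ ≤ a) :
    IsCompact {p : ℝ × ℝ | a ≤ p.2 ∧ p.2 ≤ T ∧ r₁ p.2 ≤ p.1 ∧ p.1 ≤ r₂ p.2} := by
  -- The region is the continuous image of a rectangle in the coordinates (lam, θ).
  have hK : IsCompact (Icc (0 : ℝ) 1 ×ˢ Icc a T) := isCompact_Icc.prod isCompact_Icc
  have hsub : MapsTo (fun q : ℝ × ℝ => q.2) (Icc (0 : ℝ) 1 ×ˢ Icc a T) (Ici θ₀) :=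
    fun q hq => ha.trans hq.2.1
  have hc : ContinuousOn (fun q : ℝ × ℝ => (radius r₁ r₂ q.1 q.2, q.2))
      (Icc (0 : ℝ) 1 ×ˢ Icc a T) := by
    refine ContinuousOn.prodMk ?_ continuousOn_snd
    exact ((continuousOn_const.sub continuousOn_fst).mul
      (h.cont₁.comp continuousOn_snd hsub)).add
      (continuousOn_fst.mul (h.cont₂.comp continuousOn_snd hsub))
  convert hK.image_of_continuousOn hc
  ext ⟨r, t⟩
  simp only [mem_ofPred_eq, mem_image, mem_prod, mem_Icc, Prod.exists, Prod.mk.injEq]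
  constructor
  · rintro ⟨h1, h2, h3, h4⟩
    have h12 := h.lt (ha.trans h1)
    have hd : 0 < r₂ t - r₁ t := by linarith
    refine ⟨(r - r₁ t) / (r₂ t - r₁ t), t, ⟨⟨div_nonneg (by linarith) hd.le,
      (div_le_one hd).2 (by linarith)⟩, h1, h2⟩, ?_, rfl⟩
    unfold radius
    field_simp
    ring
  · rintro ⟨lam, t', ⟨⟨h0, h1⟩, h2, h3⟩, h4, rfl⟩
    have := h.radius_mem h0 h1 (ha.trans h2)
    rw [h4] at this
    exact ⟨h2, h3, this⟩

theorem polar_mem_domainTilde {r t : ℝ} (ht : θ₀ ≤ t) (h1 : r₁ t ≤ r) (h2 : r ≤ r₂ t) :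
    polar r t ∈ domainTilde θ₀ r₁ r₂ := ⟨r, t, ht, h1, h2, rfl⟩

/-- Parameters near an interior parameter are interior. -/
theorem IsSpiral.eventually_interior (h : IsSpiral θ₀ r₁ r₂ rs Rbar) {a T r t : ℝ} (ha : θ₀ ≤ a)
    (h1 : a < t) (h2 : t < T) (h3 : r₁ t < r) (h4 : r < r₂ t) :
    ∀ᶠ p in 𝓝 (r, t), a < p.2 ∧ p.2 < T ∧ r₁ p.2 < p.1 ∧ p.1 < r₂ p.2 := by
  have hI : Ici θ₀ ∈ 𝓝 t := Ici_mem_nhds (ha.trans_lt h1)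
  have c1 : ContinuousAt (fun p : ℝ × ℝ => r₁ p.2) (r, t) :=
    ContinuousAt.comp (f := Prod.snd) (h.cont₁.continuousAt hI) continuousAt_snd
  have c2 : ContinuousAt (fun p : ℝ × ℝ => r₂ p.2) (r, t) :=
    ContinuousAt.comp (f := Prod.snd) (h.cont₂.continuousAt hI) continuousAt_snd
  exact (continuousAt_const.eventually_lt continuousAt_snd h1).and
    ((continuousAt_snd.eventually_lt continuousAt_const h2).and
    ((c1.eventually_lt continuousAt_fst h3).and (continuousAt_fst.eventually_lt c2 h4)))

/-- Openness of the domain: the local polar coordinates are continuous at the point and keep nearby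
points inside the parameter region. Smoothness on the domain thus becomes `ContDiffAt` at each
point. -/
theorem IsSpiral.domain_mem_nhds (h : IsSpiral θ₀ r₁ r₂ rs Rbar) {r t : ℝ} (ht : θ₀ < t)
    (h3 : r₁ t < r) (h4 : r < r₂ t) : domain θ₀ r₁ r₂ ∈ 𝓝 (polar r t) := by
  have hr : 0 < r := h.rs_pos.trans_le ((h.rs_le ht.le).trans h3.le)
  have h5 := (tendsto_norm_localAngle (t := t) hr).eventually
    (h.eventually_interior le_rfl ht (lt_add_one t) h3 h4)
  filter_upwards [h5, eventually_polar_eq hr] with x hx hx'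
  exact ⟨_, _, hx.1, hx.2.2.1, hx.2.2.2, hx'.symm⟩

theorem IsSpiral.exists_bound (h : IsSpiral θ₀ r₁ r₂ rs Rbar) {u : Plane → ℝ}
    (hu : ContinuousOn u (domainTilde θ₀ r₁ r₂)) (T : ℝ) :
    ∃ m > 0, ∀ r t, θ₀ ≤ t → t ≤ T → r₁ t ≤ r → r ≤ r₂ t → u (polar r t) ≤ m := by
  have hK := h.isCompact_region (T := T) le_rfl
  have hc : ContinuousOn (fun p : ℝ × ℝ => u (polar p.1 p.2))
      {p : ℝ × ℝ | θ₀ ≤ p.2 ∧ p.2 ≤ T ∧ r₁ p.2 ≤ p.1 ∧ p.1 ≤ r₂ p.2} :=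
    hu.comp continuous_polar.continuousOn
      fun p hp => polar_mem_domainTilde hp.1 hp.2.2.1 hp.2.2.2
  obtain ⟨m, hm⟩ := (hK.image_of_continuousOn hc).bddAbove
  refine ⟨max m 1, by positivity, fun r t h1 h2 h3 h4 => le_max_of_le_left ?_⟩
  exact hm ⟨(r, t), ⟨h1, h2, h3, h4⟩, rfl⟩

/-- Comparison of a subsolution with a strict barrier on a part of the spiral. -/
theorem IsSpiral.le_of_barrier (h : IsSpiral θ₀ r₁ r₂ rs Rbar)
    {A : Plane → Matrix (Fin 2) (Fin 2) ℝ} {b : Plane → Plane} {u : Plane → ℝ}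
    (hu : ContDiffOn ℝ 2 u (domain θ₀ r₁ r₂)) (huc : ContinuousOn u (domainTilde θ₀ r₁ r₂))
    (hL : ∀ x ∈ domain θ₀ r₁ r₂, ellipticOp A b u x ≤ 0)
    {a T : ℝ} (ha : θ₀ ≤ a) {V : ℝ → ℝ → ℝ} (hV : Continuous fun p : ℝ × ℝ => V p.1 p.2)
    (hbar : ∀ r t, a < t → t < T → r₁ t < r → r < r₂ t → IsStrictBarrierAt A b V r t)
    (hleft : ∀ r, r₁ a ≤ r → r ≤ r₂ a → u (polar r a) ≤ V r a)
    (hright : ∀ r, r₁ T ≤ r → r ≤ r₂ T → u (polar r T) ≤ V r T)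
    (hlat₁ : ∀ t, a ≤ t → t ≤ T → u (polar (r₁ t) t) ≤ V (r₁ t) t)
    (hlat₂ : ∀ t, a ≤ t → t ≤ T → u (polar (r₂ t) t) ≤ V (r₂ t) t)
    {r t : ℝ} (ht₁ : a ≤ t) (ht₂ : t ≤ T) (hr₁ : r₁ t ≤ r) (hr₂ : r ≤ r₂ t) :
    u (polar r t) ≤ V r t := by
  -- The maximum is taken over parameters, where `V` is single-valued.
  set K := {p : ℝ × ℝ | a ≤ p.2 ∧ p.2 ≤ T ∧ r₁ p.2 ≤ p.1 ∧ p.1 ≤ r₂ p.2}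
  have hK : IsCompact K := h.isCompact_region ha
  have hc : ContinuousOn (fun p : ℝ × ℝ => u (polar p.1 p.2) - V p.1 p.2) K :=
    (huc.comp continuous_polar.continuousOn
      fun p hp => polar_mem_domainTilde (ha.trans hp.1) hp.2.2.1 hp.2.2.2).sub hV.continuousOn
  obtain ⟨⟨r', t'⟩, ⟨h1, h2, h3, h4⟩, hmax⟩ := hK.exists_isMaxOn ⟨(r, t), ht₁, ht₂, hr₁, hr₂⟩ hc
  simp only at h1 h2 h3 h4
  have hle : u (polar r t) - V r t ≤ u (polar r' t') - V r' t' :=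
    hmax (show (r, t) ∈ K from ⟨ht₁, ht₂, hr₁, hr₂⟩)
  suffices u (polar r' t') ≤ V r' t' by linarith
  rcases h1.eq_or_lt with rfl | h1
  · exact hleft r' h3 h4
  rcases h2.eq_or_lt with rfl | h2
  · exact hright r' h3 h4
  rcases h3.eq_or_lt with rfl | h3
  · exact hlat₁ t' h1.le h2.le
  rcases h4.eq_or_lt with rfl | h4
  · exact hlat₂ t' h1.le h2.le
  have ht0 : θ₀ < t' := ha.trans_lt h1
  have hr : 0 < r' := h.rs_pos.trans_le ((h.rs_le ht0.le).trans h3.le)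
  -- Every point of the plane near the contact point has parameters (‖x‖, localAngle t' x) in `K`,
  -- so maximality over `K` is local maximality in the plane.
  have hloc : IsLocalMax (fun x => u x - V ‖x‖ (localAngle t' x)) (polar r' t') := by
    filter_upwards [(tendsto_norm_localAngle (t := t') hr).eventually
      (h.eventually_interior ha h1 h2 h3 h4), eventually_polar_eq hr] with x hx hx'
    have := hmax (show (‖x‖, localAngle t' x) ∈ K from
      ⟨hx.1.le, hx.2.1.le, hx.2.2.1.le, hx.2.2.2.le⟩)
    simpa only [hx', norm_polar hr.le, localAngle_polar, mem_ofPred_eq] using this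
  have hpos := hbar r' t' h1 h2 h3 h4 u
    (hu.contDiffAt (h.domain_mem_nhds ht0 h3 h4)) hloc
  exact absurd (hL _ ⟨r', t', ht0, h3, h4, rfl⟩) hpos.not_ge

end Geometry

/-! ### The two barriers -/

section Barriers

variable {A : Plane → Matrix (Fin 2) (Fin 2) ℝ} {b : Plane → Plane} {r t c₀ M₁ M₂ : ℝ}

/-- The barrier `m + ε (E - exp (α x₁))`. -/
theorem isStrictBarrierAt_exp (hr : 0 < r) (hc₀ : 0 < c₀)
    (hs : (A (polar r t)).IsSymm)
    (hA : ∀ ξ : Plane, c₀ * ‖ξ‖ ^ 2 ≤ ∑ i, ∑ j, ξ i * A (polar r t) i j * ξ j)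
    (hb : ‖b (polar r t)‖ ≤ M₂) {α ε : ℝ} (m E : ℝ) (hα : 0 < α) (hα' : M₂ < c₀ * α)
    (hε : 0 < ε) :
    IsStrictBarrierAt A b (fun r t => m + ε * (E - Real.exp (α * (r * Real.cos t)))) r t := by
  intro u hu hmax
  set x := polar r t
  set w := ε * Real.exp (α * x 0)
  have hw : 0 < w := by positivity
  have key : ∀ ξ : Plane, fderiv ℝ u x ξ = -w * α * ξ 0 ∧
      fderiv ℝ (fderiv ℝ u) x ξ ξ ≤ -w * α ^ 2 * ξ 0 ^ 2 := by
    intro ξ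
    have hl : ∀ s : ℝ, HasDerivAt (fun s : ℝ => α * (x 0 + s * ξ 0)) (α * ξ 0) s := fun s => by
      simpa using (((hasDerivAt_id s).mul_const (ξ 0)).const_add (x 0)).const_mul α
    have hg : ∀ s : ℝ, HasDerivAt (fun s : ℝ => m + ε * (E - Real.exp (α * (x 0 + s * ξ 0))))
        (ε * -(Real.exp (α * (x 0 + s * ξ 0)) * (α * ξ 0))) s := fun s =>
      (((hl s).exp.const_sub E).const_mul ε).const_add m
    have hg' : HasDerivAt (fun s : ℝ => ε * -(Real.exp (α * (x 0 + s * ξ 0)) * (α * ξ 0)))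
        (ε * -(Real.exp (α * (x 0 + 0 * ξ 0)) * (α * ξ 0) * (α * ξ 0))) 0 :=
      (((hl 0).exp.mul_const (α * ξ 0)).fun_neg).const_mul ε
    have hm : IsLocalMax (fun s : ℝ => u (x + s • ξ)
        - (m + ε * (E - Real.exp (α * (x 0 + s * ξ 0))))) 0 := by
      filter_upwards [(tendsto_add_smul x ξ).eventually hmax,
        (tendsto_add_smul x ξ).eventually (eventually_polar_eq hr)] with s h1 h2
      -- The barrier depends only on the first Cartesian coordinate, which is affine along the line.
      have e : ‖x + s • ξ‖ * Real.cos (localAngle t (x + s • ξ)) = x 0 + s * ξ 0 := by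
        rw [← polar_zero, h2]; simp
      have e' : ‖x‖ * Real.cos (localAngle t x) = x 0 := by
        rw [localAngle_polar, norm_polar hr.le, ← polar_zero]
      rw [e, e'] at h1
      simpa using h1
    obtain ⟨h1, h2⟩ := fderiv_compare_of_touch hu (Eventually.of_forall hg) hg' hm
    refine ⟨h1.trans ?_, h2.trans_eq ?_⟩ <;> simp [w] <;> ring
  -- Only the first direction contributes: the operator is at least w α (α a₁₁ - b₁) ≥ w α (c₀ α -
  -- M₂) > 0.
  have h1 := le_ellipticOp_of_forall (b := b) (α := 0) (β := w * α ^ 2) (v := !₂[1, 0]) hu hs hc₀ hA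
    (fun ξ => (key ξ).2.trans_eq (by simp))
  refine lt_of_lt_of_le ?_ h1
  rw [(key _).1]
  have h2 := hA !₂[1, 0]
  rw [norm_sq_plane] at h2
  have h3 : b x 0 ≤ M₂ := by
    refine le_trans ?_ hb
    refine le_trans (le_abs_self _) (abs_le_of_sq_le_sq ?_ (norm_nonneg _))
    rw [norm_sq_plane]; nlinarith [sq_nonneg (b x 1)]
  simp [Fin.sum_univ_two] at h2 ⊢
  have h4 : 0 < w * α := by positivity
  have h5 : 0 < w * α * (c₀ * α - M₂) := mul_pos h4 (by linarith)
  nlinarith [mul_le_mul_of_nonneg_left h2 (mul_pos h4 hα).le, mul_le_mul_of_nonneg_left h3 h4.le]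

/-- Directional derivatives of a function touched from above by `F(θ) (1 - (r² - rs²)²)`. -/
theorem fderiv_compare_mul {u : Plane → ℝ} {rs κ : ℝ} {F F' : ℝ → ℝ} (hr : 0 < r)
    (hF : ∀ τ, HasDerivAt F (F' τ) τ) (hF' : ∀ τ, HasDerivAt F' (κ * F τ) τ)
    (hu : ContDiffAt ℝ 2 u (polar r t))
    (hmax : IsLocalMax (fun x => u x - F (localAngle t x) * (1 - (‖x‖ ^ 2 - rs ^ 2) ^ 2))
      (polar r t)) (ξ : Plane) :
    fderiv ℝ u (polar r t) ξ = F' t * (angularPart t ξ / r) * (1 - (r ^ 2 - rs ^ 2) ^ 2)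
        + F t * (-(2 * (r ^ 2 - rs ^ 2) * (2 * r * radialPart t ξ))) ∧
      fderiv ℝ (fderiv ℝ u) (polar r t) ξ ξ
        ≤ (κ * F t * (angularPart t ξ / r) ^ 2
          + F' t * (-2 * radialPart t ξ * angularPart t ξ / r ^ 2)) * (1 - (r ^ 2 - rs ^ 2) ^ 2)
          + 2 * (F' t * (angularPart t ξ / r) *
            (-(2 * (r ^ 2 - rs ^ 2) * (2 * r * radialPart t ξ))))
          + F t * (-(2 * (2 * r * radialPart t ξ) ^ 2 + 4 * (r ^ 2 - rs ^ 2) * ‖ξ‖ ^ 2)) := by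
  set x := polar r t
  have hnx : ‖x‖ = r := norm_polar hr.le t
  set σ := r ^ 2 - rs ^ 2
  set a := radialPart t ξ
  set c := angularPart t ξ
  obtain ⟨hh, hh'⟩ := hasDerivAt_localAngle_line (t := t) hr ξ
  set h := fun s : ℝ => localAngle t (x + s • ξ) with hhdef
  set h' := fun s : ℝ => r * c / ‖x + s • ξ‖ ^ 2 with hhdef'
  -- The squared radius is quadratic along a line. This is why the profile uses r² rather than r:
  -- its restriction `P` is a polynomial.
  have hn : ∀ s : ℝ, ‖x + s • ξ‖ ^ 2 = r ^ 2 + s * (2 * r * a) + s ^ 2 * ‖ξ‖ ^ 2 := fun s => by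
    rw [← radialPart_sq_add_angularPart_sq t, ← radialPart_sq_add_angularPart_sq t ξ,
      radialPart_add_smul, angularPart_add_smul, radialPart_polar, angularPart_polar]
    ring
  have h0 : h 0 = t := by simp [h, x, localAngle_polar]
  have h'0 : h' 0 = c / r := by simp [h', hnx]; field_simp
  set P := fun s : ℝ => 1 - (r ^ 2 + s * (2 * r * a) + s ^ 2 * ‖ξ‖ ^ 2 - rs ^ 2) ^ 2 with hP
  set P' := fun s : ℝ => -(2 * (r ^ 2 + s * (2 * r * a) + s ^ 2 * ‖ξ‖ ^ 2 - rs ^ 2)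
    * (2 * r * a + 2 * s * ‖ξ‖ ^ 2)) with hP'
  have hd : ∀ s : ℝ, HasDerivAt
      (fun s : ℝ => r ^ 2 + s * (2 * r * a) + s ^ 2 * ‖ξ‖ ^ 2 - rs ^ 2)
      (2 * r * a + 2 * s * ‖ξ‖ ^ 2) s := fun s => by
    have h1 : HasDerivAt (fun s : ℝ => s * (2 * r * a)) (2 * r * a) s := by
      simpa using (hasDerivAt_id s).mul_const (2 * r * a)
    have h2 : HasDerivAt (fun s : ℝ => s ^ 2 * ‖ξ‖ ^ 2) (2 * s * ‖ξ‖ ^ 2) s := by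
      simpa using (hasDerivAt_pow 2 s).mul_const (‖ξ‖ ^ 2)
    exact ((h1.const_add (r ^ 2)).fun_add h2).sub_const (rs ^ 2)
  have hPd : ∀ s, HasDerivAt P (P' s) s := fun s =>
    (((hd s).fun_pow 2).const_sub 1).congr_deriv (by simp [hP'])
  have hP'd : HasDerivAt P' (-(2 * (2 * r * a) ^ 2 + 4 * σ * ‖ξ‖ ^ 2)) 0 := by
    have h2 : HasDerivAt (fun s : ℝ => 2 * r * a + 2 * s * ‖ξ‖ ^ 2) (2 * ‖ξ‖ ^ 2) 0 := by
      simpa using (((hasDerivAt_id (0 : ℝ)).const_mul 2).mul_const (‖ξ‖ ^ 2)).const_add (2 * r * a)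
    exact ((((hd 0).const_mul 2).fun_mul h2).fun_neg).congr_deriv (by simp [σ]; ring)
  have hg : ∀ᶠ s in 𝓝 (0 : ℝ), HasDerivAt (fun s => F (h s) * P s)
      (F' (h s) * h' s * P s + F (h s) * P' s) s := by
    filter_upwards [hh] with s hs
    exact ((hF (h s)).comp s hs).fun_mul (hPd s)
  have hg' : HasDerivAt (fun s => F' (h s) * h' s * P s + F (h s) * P' s)
      (((κ * F (h 0)) * h' 0 * h' 0 + F' (h 0) * (-2 * a * c / r ^ 2)) * P 0
        + F' (h 0) * h' 0 * P' 0
        + (F' (h 0) * h' 0 * P' 0 + F (h 0) * (-(2 * (2 * r * a) ^ 2 + 4 * σ * ‖ξ‖ ^ 2)))) 0 :=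
    ((((hF' (h 0)).comp (0 : ℝ) hh.self_of_nhds).fun_mul hh').fun_mul (hPd 0)).fun_add
      (((hF (h 0)).comp (0 : ℝ) hh.self_of_nhds).fun_mul hP'd)
  have hm : IsLocalMax (fun s : ℝ => u (x + s • ξ) - F (h s) * P s) 0 := by
    filter_upwards [(tendsto_add_smul x ξ).eventually hmax] with s h1
    rw [hn s, hnx, localAngle_polar] at h1
    simpa [h0, hP, ← hhdef] using h1
  obtain ⟨h1, h2⟩ := fderiv_compare_of_touch hu hg hg' hm
  have P0 : P 0 = 1 - σ ^ 2 := by simp [hP, σ]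
  have P'0 : P' 0 = -(2 * σ * (2 * r * a)) := by simp [hP', σ]
  rw [h0, h'0, P0, P'0] at h1 h2
  refine ⟨h1, h2.trans_eq ?_⟩
  ring

/-- The second derivatives of `F(θ) (1 - (r² - rs²)²)` are bounded above in a thin annulus. -/
theorem thin_second_le {ν e f a c rs σ N : ℝ} (hr : 0 < r) (hrs : 0 < rs) (hrsr : rs ≤ r)
    (he : 0 < e) (hf : |f| ≤ ν * e) (hν : 0 < ν) (hν1 : ν ≤ 1 / 2) (hσ0 : 0 ≤ σ) (hσν : σ ≤ ν)
    (hac : a ^ 2 + c ^ 2 = N) :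
    (ν ^ 2 * e * (c / r) ^ 2 + f * (-2 * a * c / r ^ 2)) * (1 - σ ^ 2)
      + 2 * (f * (c / r) * (-(2 * σ * (2 * r * a))))
      + e * (-(2 * (2 * r * a) ^ 2 + 4 * σ * N))
      ≤ (e * ν * (2 / rs ^ 2 + 8)) * N - (8 * e) * (r * a) ^ 2 := by
  have hN : 0 ≤ N := by rw [← hac]; positivity
  have hφ0 : 0 ≤ 1 - σ ^ 2 := by nlinarith
  have hφ1 : 1 - σ ^ 2 ≤ 1 := by nlinarith
  have hir2 : 1 / r ^ 2 ≤ 1 / rs ^ 2 := one_div_le_one_div_of_le (by positivity) (by gcongr)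
  have hνe : 0 < ν * e := by positivity
  have hac2 : |2 * a * c| ≤ N := by
    rw [← hac]
    exact abs_le.2 ⟨by nlinarith [sq_nonneg (a + c)], by nlinarith [sq_nonneg (a - c)]⟩
  have hFac : |f * (2 * a * c)| ≤ ν * e * N := by
    rw [abs_mul]
    exact mul_le_mul hf hac2 (abs_nonneg _) hνe.le
  have hneg : -(f * (2 * a * c)) ≤ ν * e * N := neg_le.1 (neg_le_of_abs_le hFac)
  -- Both angular terms are of order ν, since F'' = ν² F with ν ≤ 1 and |F'| ≤ ν F.
  have t1 : ν ^ 2 * e * (c / r) ^ 2 + f * (-2 * a * c / r ^ 2)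
      ≤ e * ν * (2 / rs ^ 2) * N := by
    have e1 : ν ^ 2 * e * (c / r) ^ 2 + f * (-2 * a * c / r ^ 2)
        = (ν * e * (ν * c ^ 2) + -(f * (2 * a * c))) * (1 / r ^ 2) := by
      field_simp
    have e2 : ν * e * (ν * c ^ 2) ≤ ν * e * N := by
      refine mul_le_mul_of_nonneg_left ?_ hνe.le
      nlinarith [sq_nonneg a, sq_nonneg c]
    calc _ = _ := e1
      _ ≤ (ν * e * N + ν * e * N) * (1 / r ^ 2) :=
        mul_le_mul_of_nonneg_right (add_le_add e2 hneg) (by positivity)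
      _ ≤ (ν * e * N + ν * e * N) * (1 / rs ^ 2) :=
        mul_le_mul_of_nonneg_left hir2 (by positivity)
      _ = _ := by ring
  have t2 : (ν ^ 2 * e * (c / r) ^ 2 + f * (-2 * a * c / r ^ 2)) * (1 - σ ^ 2)
      ≤ e * ν * (2 / rs ^ 2) * N :=
    (mul_le_mul_of_nonneg_right t1 hφ0).trans (mul_le_of_le_one_right (by positivity) hφ1)
  have t3 : 2 * (f * (c / r) * (-(2 * σ * (2 * r * a)))) ≤ e * ν * 8 * N := by
    have e1 : 2 * (f * (c / r) * (-(2 * σ * (2 * r * a)))) = 4 * σ * -(f * (2 * a * c)) := by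
      field_simp
      ring
    have h2 : 0 ≤ ν * e * N := by positivity
    rw [e1]
    calc 4 * σ * -(f * (2 * a * c)) ≤ 4 * σ * (ν * e * N) :=
          mul_le_mul_of_nonneg_left hneg (by positivity)
      _ ≤ 8 * (ν * e * N) := mul_le_mul_of_nonneg_right (by linarith) h2
      _ = _ := by ring
  -- The isotropic part of the Hessian of -σ² has a favourable sign and is discarded; the rank-one
  -- part is the term -8 e (r a)² kept in the bound.
  have t4 : 0 ≤ e * (4 * σ * N) := by positivity
  linarith

/-- The gradient of `F(θ) (1 - (r² - rs²)²)` is small in a thin annulus. -/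
theorem thin_first_ge {ν e f a c rs Rbar σ : ℝ} (hr : 0 < r) (hrs : 0 < rs) (hrsr : rs ≤ r)
    (hrR : r ≤ Rbar) (he : 0 < e) (hf : |f| ≤ ν * e) (hν : 0 < ν) (hν1 : ν ≤ 1 / 2)
    (hσ0 : 0 ≤ σ) (hσν : σ ≤ ν) (hM₂ : 0 ≤ M₂) (ha : |a| ≤ M₂) (hc : |c| ≤ M₂) :
    -(e * (ν * (M₂ * (1 / rs + 4 * Rbar))))
      ≤ f * (c / r) * (1 - σ ^ 2) + e * (-(2 * σ * (2 * r * a))) := by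
  have hφ0 : 0 ≤ 1 - σ ^ 2 := by nlinarith
  have hφ1 : 1 - σ ^ 2 ≤ 1 := by nlinarith
  have hir : 1 / r ≤ 1 / rs := one_div_le_one_div_of_le hrs hrsr
  have hνe : 0 < ν * e := by positivity
  have s1 : |f * (c / r) * (1 - σ ^ 2)| ≤ ν * e * (M₂ * (1 / rs)) := by
    rw [abs_mul, abs_mul, abs_div, abs_of_pos hr, abs_of_nonneg hφ0]
    refine (mul_le_of_le_one_right (by positivity) hφ1).trans ?_
    refine mul_le_mul hf ?_ (by positivity) hνe.le
    rw [div_eq_mul_one_div]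
    exact mul_le_mul hc hir (by positivity) hM₂
  have hR : 0 < Rbar := hr.trans_le hrR
  have s2 : 2 * σ * (2 * r * a) ≤ ν * (M₂ * (4 * Rbar)) := by
    have : a ≤ M₂ := (le_abs_self a).trans ha
    calc 2 * σ * (2 * r * a) ≤ 2 * σ * (2 * r * M₂) := by gcongr
      _ ≤ 2 * ν * (2 * Rbar * M₂) := by gcongr
      _ = _ := by ring
  have s3 := mul_le_mul_of_nonneg_left s2 he.le
  have s4 := neg_le_of_abs_le s1
  linarith

/-- The barrier `E(θ) (1 - (r² - rs²)²)` in a thin annulus. -/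
theorem isStrictBarrierAt_mul {rs Rbar ν : ℝ} {F F' : ℝ → ℝ} (hr : 0 < r) (hc₀ : 0 < c₀)
    (hs : (A (polar r t)).IsSymm)
    (hA : ∀ ξ : Plane, c₀ * ‖ξ‖ ^ 2 ≤ ∑ i, ∑ j, ξ i * A (polar r t) i j * ξ j)
    (htr : (A (polar r t)).trace ≤ M₁) (hb : ‖b (polar r t)‖ ≤ M₂) (hM₂ : 0 ≤ M₂)
    (hrs : 0 < rs) (hrsr : rs ≤ r) (hrR : r ≤ Rbar) (hν : 0 < ν) (hν1 : ν ≤ 1 / 2)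
    (hthin : r ^ 2 - rs ^ 2 ≤ ν)
    (hsmall : ν * (M₁ * (2 / rs ^ 2 + 8) + M₂ * (1 / rs + 4 * Rbar)) < 8 * c₀ * rs ^ 2)
    (hF : ∀ τ, HasDerivAt F (F' τ) τ) (hF' : ∀ τ, HasDerivAt F' (ν ^ 2 * F τ) τ)
    (hFpos : ∀ τ, 0 < F τ) (hFF' : ∀ τ, |F' τ| ≤ ν * F τ) :
    IsStrictBarrierAt A b (fun r t => F t * (1 - (r ^ 2 - rs ^ 2) ^ 2)) r t := by
  intro u hu hmax
  have hσ0 : 0 ≤ r ^ 2 - rs ^ 2 := by nlinarith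
  have he := hFpos t
  have key := fderiv_compare_mul hr hF hF' hu hmax
  have hnx : ‖polar r t‖ = r := norm_polar hr.le t
  have second : ∀ ξ : Plane, fderiv ℝ (fderiv ℝ u) (polar r t) ξ ξ
      ≤ (F t * ν * (2 / rs ^ 2 + 8)) * ‖ξ‖ ^ 2
        - (8 * F t) * (polar r t 0 * ξ 0 + polar r t 1 * ξ 1) ^ 2 := by
    intro ξ
    have hx : polar r t 0 * ξ 0 + polar r t 1 * ξ 1 = r * radialPart t ξ := by
      rw [polar_zero, polar_one, radialPart]; ring
    rw [hx]
    exact (key ξ).2.trans (thin_second_le hr hrs hrsr he (hFF' t) hν hν1 hσ0 hthin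
      (radialPart_sq_add_angularPart_sq t ξ))
  refine lt_of_lt_of_le ?_ (le_ellipticOp_of_forall (b := b) hu hs hc₀ hA second)
  have g1 : -(F t * (ν * (M₂ * (1 / rs + 4 * Rbar)))) ≤ fderiv ℝ u (polar r t) (b (polar r t)) := by
    rw [(key _).1]
    exact thin_first_ge hr hrs hrsr hrR he (hFF' t) hν hν1 hσ0 hthin hM₂
      ((abs_radialPart_le t _).trans hb) ((abs_angularPart_le t _).trans hb)
  -- Multiplied by 8 F, this is the gain from radial concavity; `hsmall` says that it beats all the
  -- errors of order ν.
  have g2 : c₀ * rs ^ 2 ≤ ∑ i, ∑ j, polar r t i * A (polar r t) i j * polar r t j := by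
    refine le_trans ?_ (hA (polar r t))
    rw [hnx]
    gcongr
  have g3 : F t * ν * (2 / rs ^ 2 + 8) * (A (polar r t)).trace
      ≤ F t * ν * (2 / rs ^ 2 + 8) * M₁ :=
    mul_le_mul_of_nonneg_left htr (by positivity)
  have g4 := mul_lt_mul_of_pos_left hsmall he
  have g5 := mul_le_mul_of_nonneg_left g2 (show 0 ≤ 8 * F t by positivity)
  linarith

end Barriers

end Spiral

/-! ### Arc-length against angle -/

namespace Spiral

theorem norm_deriv_curve_sq {r₁ r₂ : ℝ → ℝ} {lam θ d : ℝ}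
    (hd : HasDerivAt (radius r₁ r₂ lam) d θ) :
    ‖deriv (curve r₁ r₂ lam) θ‖ ^ 2 = radius r₁ r₂ lam θ ^ 2 + d ^ 2 := by
  set R := radius r₁ r₂ lam
  have h : HasDerivAt (curve r₁ r₂ lam)
      (!₂[d * Real.cos θ + R θ * -Real.sin θ, d * Real.sin θ + R θ * Real.cos θ] : Plane) θ := by
    have hp : HasDerivAt (fun θ => ![R θ * Real.cos θ, R θ * Real.sin θ])
        ![d * Real.cos θ + R θ * -Real.sin θ, d * Real.sin θ + R θ * Real.cos θ] θ := by
      rw [hasDerivAt_pi]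
      intro i
      fin_cases i
      · simpa using hd.fun_mul (Real.hasDerivAt_cos θ)
      · simpa using hd.fun_mul (Real.hasDerivAt_sin θ)
    exact (PiLp.hasFDerivAt_toLp (𝕜 := ℝ) 2 _).comp_hasDerivAt θ hp
  rw [h.deriv, norm_sq_plane]
  simp only [Matrix.cons_val_zero, Matrix.cons_val_one]
  linear_combination (R θ ^ 2 + d ^ 2) * Real.cos_sq_add_sin_sq θ

theorem ae_abs_deriv_le_derivSupNorm {ρ : ℝ → ℝ} {Θ : ℝ}
    (h : MemLp (deriv ρ) ⊤ (volume.restrict (Ioi Θ))) :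
    ∀ᵐ η, Θ < η → |deriv ρ η| ≤ derivSupNorm ρ Θ := by
  have h1 := (ae_restrict_iff' measurableSet_Ioi).1
    (ae_le_eLpNormEssSup (f := deriv ρ) (μ := volume.restrict (Ioi Θ)))
  filter_upwards [h1] with η hη hlt
  have h2 := hη hlt
  rw [← eLpNorm_exponent_top] at h2
  have h3 := ENNReal.toReal_mono h.2.ne h2
  simpa [derivSupNorm] using h3

theorem derivSupNorm_nonneg (ρ : ℝ → ℝ) (Θ : ℝ) : 0 ≤ derivSupNorm ρ Θ := ENNReal.toReal_nonneg

variable {θ₀ : ℝ} {r₁ r₂ : ℝ → ℝ} {rs Rbar : ℝ}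

/-- Almost everywhere bounds for the speed of the curves `X_lam`. -/
theorem IsSpiral.ae_norm_deriv_curve (h : IsSpiral θ₀ r₁ r₂ rs Rbar) {Θ : ℝ}
    (hreg₁ : RegularBoundary θ₀ Θ r₁) (hreg₂ : RegularBoundary θ₀ Θ r₂) {lam θ : ℝ}
    (h0 : 0 ≤ lam) (h1 : lam ≤ 1) :
    ∀ᵐ η, η ∈ Ioc θ₀ θ → rs ≤ ‖deriv (curve r₁ r₂ lam) η‖ ∧
      ‖deriv (curve r₁ r₂ lam) η‖ ≤ (Rbar + mu0 r₁ r₂ Θ)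
        + (Iic Θ).indicator (fun η => |deriv r₁ η| + |deriv r₂ η|) η := by
  rcases lt_or_ge θ θ₀ with hθ | hθ
  · simp [Ioc_eq_empty hθ.not_gt]
  have hu : uIcc θ₀ θ = Icc θ₀ θ := uIcc_of_le hθ
  filter_upwards [(hreg₁.1 θ hθ).ae_differentiableAt, (hreg₂.1 θ hθ).ae_differentiableAt,
    ae_abs_deriv_le_derivSupNorm hreg₁.2, ae_abs_deriv_le_derivSupNorm hreg₂.2]
    with η d1 d2 e1 e2 hη
  rw [hu] at d1 d2
  replace d1 := (d1 (Ioc_subset_Icc_self hη)).hasDerivAt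
  replace d2 := (d2 (Ioc_subset_Icc_self hη)).hasDerivAt
  have hR := norm_deriv_curve_sq (r₁ := r₁) (r₂ := r₂) (lam := lam)
    ((d1.const_mul (1 - lam)).fun_add (d2.const_mul lam))
  set d := (1 - lam) * deriv r₁ η + lam * deriv r₂ η
  set R := radius r₁ r₂ lam η
  obtain ⟨m1, m2⟩ := h.radius_mem h0 h1 hη.1.le
  have hRs : rs ≤ R := (h.rs_le hη.1.le).trans m1
  have hRp : 0 < R := h.rs_pos.trans_le hRs
  have hRb : R ≤ Rbar := m2.trans (h.bound _ hη.1.le)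
  have hd : |d| ≤ (1 - lam) * |deriv r₁ η| + lam * |deriv r₂ η| := by
    refine (abs_add_le _ _).trans_eq ?_
    rw [abs_mul, abs_mul, abs_of_nonneg h0, abs_of_nonneg (sub_nonneg.2 h1)]
  have hup : ‖deriv (curve r₁ r₂ lam) η‖ ≤ R + |d| := by
    refine (pow_le_pow_iff_left₀ (norm_nonneg _) (by positivity) two_ne_zero).1 ?_
    rw [hR, ← sq_abs d]
    nlinarith [abs_nonneg d]
  constructor
  · refine hRs.trans ((pow_le_pow_iff_left₀ hRp.le (norm_nonneg _) two_ne_zero).1 ?_)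
    rw [hR]
    nlinarith [sq_nonneg d]
  · have n1 := derivSupNorm_nonneg r₁ Θ
    -- Up to `Θ` the derivatives are merely integrable, so they are carried along; beyond it the
    -- convex combination is at most μ₀.
    by_cases hΘ : η ≤ Θ
    · rw [indicator_of_mem (by exact hΘ)]
      have n2 : 0 ≤ mu0 r₁ r₂ Θ := n1.trans (le_max_left _ _)
      have := mul_nonneg h0 (abs_nonneg (deriv r₁ η))
      have := mul_nonneg (sub_nonneg.2 h1) (abs_nonneg (deriv r₂ η))
      linarith
    · rw [indicator_of_notMem (by exact hΘ)]
      have l1 : |deriv r₁ η| ≤ mu0 r₁ r₂ Θ := (e1 (not_le.1 hΘ)).trans (le_max_left _ _)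
      have l2 : |deriv r₂ η| ≤ mu0 r₁ r₂ Θ := (e2 (not_le.1 hΘ)).trans (le_max_right _ _)
      have := mul_le_mul_of_nonneg_left l1 (sub_nonneg.2 h1)
      have := mul_le_mul_of_nonneg_left l2 h0
      linarith

/-- Linear bounds for the arc-length in terms of the angle. -/
theorem IsSpiral.arcLength_bounds (h : IsSpiral θ₀ r₁ r₂ rs Rbar) {Θ : ℝ} (hΘ : θ₀ ≤ Θ)
    (hreg₁ : RegularBoundary θ₀ Θ r₁) (hreg₂ : RegularBoundary θ₀ Θ r₂) {lam θ : ℝ}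
    (h0 : 0 ≤ lam) (h1 : lam ≤ 1) (hθ : θ₀ ≤ θ) :
    rs * (θ - θ₀) ≤ arcLength θ₀ r₁ r₂ lam θ ∧
      arcLength θ₀ r₁ r₂ lam θ ≤ (∫ η in Ioc θ₀ Θ, (|deriv r₁ η| + |deriv r₂ η|))
        + (Rbar + mu0 r₁ r₂ Θ) * (θ - θ₀) := by
  set g : ℝ → ℝ := fun η => |deriv r₁ η| + |deriv r₂ η|
  have hgi : ∀ T, θ₀ ≤ T → IntegrableOn g (Ioc θ₀ T) := fun T hT =>
    ((hreg₁.1 T hT).intervalIntegrable_deriv.1.abs).add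
      ((hreg₂.1 T hT).intervalIntegrable_deriv.1.abs)
  have hae := (ae_restrict_iff' (measurableSet_Ioc (a := θ₀) (b := θ))).2
    (h.ae_norm_deriv_curve hreg₁ hreg₂ (θ := θ) h0 h1)
  have hci : IntegrableOn (fun _ : ℝ => Rbar + mu0 r₁ r₂ Θ) (Ioc θ₀ θ) := by simp
  have hii : IntegrableOn ((Iic Θ).indicator g) (Ioc θ₀ θ) :=
    (hgi θ hθ).indicator measurableSet_Iic
  have hint : IntegrableOn (fun η => ‖deriv (curve r₁ r₂ lam) η‖) (Ioc θ₀ θ) := by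
    refine (hci.add hii).mono' (measurable_deriv _).norm.aestronglyMeasurable ?_
    filter_upwards [hae] with η hη
    rw [norm_norm]
    exact hη.2
  rw [arcLength, intervalIntegral.integral_of_le hθ]
  constructor
  · have h2 : ∫ _ in Ioc θ₀ θ, rs ≤ ∫ η in Ioc θ₀ θ, ‖deriv (curve r₁ r₂ lam) η‖ :=
      integral_mono_ae (by simp) hint (hae.mono fun η hη => hη.1)
    rw [setIntegral_const] at h2
    simpa [Measure.real, hθ, mul_comm] using h2
  · have h2 : ∫ η in Ioc θ₀ θ, ‖deriv (curve r₁ r₂ lam) η‖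
        ≤ ∫ η in Ioc θ₀ θ, ((Rbar + mu0 r₁ r₂ Θ) + (Iic Θ).indicator g η) :=
      integral_mono_ae hint (hci.add hii) (hae.mono fun η hη => hη.2)
    rw [integral_add hci hii, setIntegral_const, setIntegral_indicator measurableSet_Iic] at h2
    -- The part before `Θ` costs a constant independent of lam and θ.
    have h3 : ∫ η in Ioc θ₀ θ ∩ Iic Θ, g η ≤ ∫ η in Ioc θ₀ Θ, g η := by
      refine setIntegral_mono_set (hgi Θ hΘ) (Eventually.of_forall fun η => ?_) ?_
      · exact add_nonneg (abs_nonneg _) (abs_nonneg _)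
      · exact Eventually.of_forall fun η hη => ⟨hη.1.1, hη.2⟩
    have h4 : volume.real (Ioc θ₀ θ) • (Rbar + mu0 r₁ r₂ Θ)
        = (Rbar + mu0 r₁ r₂ Θ) * (θ - θ₀) := by
      simp [Measure.real, hθ, mul_comm]
    rw [h4] at h2
    linarith

/-- Linear bounds for the arc-distance in terms of the angle. -/
theorem IsSpiral.arcDist_bounds (h : IsSpiral θ₀ r₁ r₂ rs Rbar) {Θ : ℝ} (hΘ : θ₀ ≤ Θ)
    (hreg₁ : RegularBoundary θ₀ Θ r₁) (hreg₂ : RegularBoundary θ₀ Θ r₂) {r θ : ℝ}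
    (hθ : θ₀ ≤ θ) (h1 : r₁ θ ≤ r) (h2 : r ≤ r₂ θ) :
    rs * (θ - θ₀) ≤ arcDist θ₀ r₁ r₂ (polar r θ) ∧
      arcDist θ₀ r₁ r₂ (polar r θ) ≤ (∫ η in Ioc θ₀ Θ, (|deriv r₁ η| + |deriv r₂ η|))
        + (Rbar + mu0 r₁ r₂ Θ) * (θ - θ₀) := by
  have hu := existsUnique_isCoord (fun θ hθ => h.rs_pos.trans_le (h.rs_le hθ)) h.nested
    (polar_mem_domainTilde hθ h1 h2)
  have hd : 0 < r₂ θ - r₁ θ := sub_pos.2 (h.lt hθ)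
  have hc : IsCoord θ₀ r₁ r₂ (polar r θ) ((r - r₁ θ) / (r₂ θ - r₁ θ), θ) := by
    refine ⟨div_nonneg (by linarith) hd.le, (div_le_one hd).2 (by linarith), hθ, ?_⟩
    have : radius r₁ r₂ ((r - r₁ θ) / (r₂ θ - r₁ θ)) θ = r := by
      unfold radius
      field_simp
      ring
    simp only [curve, this]
  have hs := hu.exists.choose_spec
  -- Uniqueness identifies the pair chosen in `arcDist` with the explicit one, whose angle is θ.
  have he := hu.unique hs hc
  rw [arcDist, dif_pos hu.exists, he]
  exact h.arcLength_bounds hΘ hreg₁ hreg₂ hc.1 hc.2.1 hθ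

end Spiral

/-! ### Decay or growth of subsolutions -/

namespace Spiral

/-- Subsolutions of `L u ≤ 0` that are nonpositive on the lateral boundary. -/
structure IsSubsolution (θ₀ : ℝ) (r₁ r₂ : ℝ → ℝ) (A : Plane → Matrix (Fin 2) (Fin 2) ℝ)
    (b : Plane → Plane) (u : Plane → ℝ) : Prop where
  smooth : ContDiffOn ℝ 2 u (domain θ₀ r₁ r₂)
  cont : ContinuousOn u (domainTilde θ₀ r₁ r₂)
  op : ∀ x ∈ domain θ₀ r₁ r₂, ellipticOp A b u x ≤ 0
  lateral : ∀ x ∈ lateralBoundary θ₀ r₁ r₂, u x ≤ 0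

variable {θ₀ : ℝ} {r₁ r₂ : ℝ → ℝ} {rs Rbar : ℝ} {A : Plane → Matrix (Fin 2) (Fin 2) ℝ}
  {b : Plane → Plane} {c₀ M₁ M₂ : ℝ} {u v : Plane → ℝ}

theorem IsSubsolution.lateral₁ (hu : IsSubsolution θ₀ r₁ r₂ A b u) {t : ℝ} (ht : θ₀ ≤ t) :
    u (polar (r₁ t) t) ≤ 0 := hu.lateral _ (Or.inl ⟨t, ht, rfl⟩)

theorem IsSubsolution.lateral₂ (hu : IsSubsolution θ₀ r₁ r₂ A b u) {t : ℝ} (ht : θ₀ ≤ t) :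
    u (polar (r₂ t) t) ≤ 0 := hu.lateral _ (Or.inr ⟨t, ht, rfl⟩)

/-- The weak maximum principle between two cross-sections. -/
theorem IsSubsolution.le_of_le_ends (h : IsSpiral θ₀ r₁ r₂ rs Rbar) (hc₀ : 0 < c₀) (hM₂ : 0 ≤ M₂)
    (hA : UniformlyElliptic (domain θ₀ r₁ r₂) A c₀ M₁) (hb : ∀ x ∈ domain θ₀ r₁ r₂, ‖b x‖ ≤ M₂)
    (hu : IsSubsolution θ₀ r₁ r₂ A b u) {T m : ℝ} (hm : 0 ≤ m)
    (hleft : ∀ r, r₁ θ₀ ≤ r → r ≤ r₂ θ₀ → u (polar r θ₀) ≤ m)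
    (hright : ∀ r, r₁ T ≤ r → r ≤ r₂ T → u (polar r T) ≤ m)
    {r t : ℝ} (ht₁ : θ₀ ≤ t) (ht₂ : t ≤ T) (hr₁ : r₁ t ≤ r) (hr₂ : r ≤ r₂ t) :
    u (polar r t) ≤ m := by
  set α := M₂ / c₀ + 1
  have hα : 0 < α := by positivity
  have hα' : M₂ < c₀ * α := by
    have : c₀ * α = M₂ + c₀ := by simp only [α]; field_simp
    linarith
  set E := Real.exp (α * Rbar)
  have hE : 0 < E := Real.exp_pos _
  have hpos : ∀ {ρ θ : ℝ}, θ₀ ≤ θ → r₁ θ ≤ ρ → 0 < ρ := fun hθ hρ =>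
    h.rs_pos.trans_le ((h.rs_le hθ).trans hρ)
  -- With ε = δ / E the barrier lies between m and m + δ on the whole region.
  refine le_of_forall_pos_le_add fun δ hδ => ?_
  have hε : 0 < δ / E := by positivity
  have hVm : ∀ {ρ θ : ℝ}, θ₀ ≤ θ → r₁ θ ≤ ρ → ρ ≤ r₂ θ →
      m ≤ m + δ / E * (E - Real.exp (α * (ρ * Real.cos θ))) := by
    intro ρ θ hθ h1 h2
    have h3 : ρ * Real.cos θ ≤ Rbar := (mul_le_of_le_one_right (hpos hθ h1).le
      (Real.cos_le_one θ)).trans (h2.trans (h.bound θ hθ))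
    have h4 : Real.exp (α * (ρ * Real.cos θ)) ≤ E :=
      Real.exp_le_exp.2 (mul_le_mul_of_nonneg_left h3 hα.le)
    exact le_add_of_nonneg_right (mul_nonneg hε.le (sub_nonneg.2 h4))
  have hcomp := h.le_of_barrier hu.smooth hu.cont hu.op le_rfl (T := T)
    (V := fun r t => m + δ / E * (E - Real.exp (α * (r * Real.cos t)))) (by fun_prop)
    (fun ρ θ h1 _ h3 h4 => by
      have hx : polar ρ θ ∈ domain θ₀ r₁ r₂ := ⟨ρ, θ, h1, h3, h4, rfl⟩
      exact isStrictBarrierAt_exp (hpos h1.le h3.le) hc₀ (hA _ hx).1 (hA _ hx).2.1 (hb _ hx)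
        m E hα hα' hε)
    (fun ρ h1 h2 => (hleft ρ h1 h2).trans (hVm le_rfl h1 h2))
    (fun ρ h1 h2 => (hright ρ h1 h2).trans (hVm (ht₁.trans ht₂) h1 h2))
    (fun θ h1 _ => ((hu.lateral₁ h1).trans hm).trans (hVm h1 le_rfl (h.lt h1).le))
    (fun θ h1 _ => ((hu.lateral₂ h1).trans hm).trans (hVm h1 (h.lt h1).le le_rfl))
    ht₁ ht₂ hr₁ hr₂
  refine hcomp.trans ?_
  have h5 := mul_nonneg hε.le (Real.exp_pos (α * (r * Real.cos t))).le
  have h6 : δ / E * E = δ := by field_simp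
  simp only [mul_sub, h6]
  linarith

/-- In the thin part of the spiral, subsolutions obey a two-sided exponential estimate. -/
theorem IsSpiral.exists_decay (h : IsSpiral θ₀ r₁ r₂ rs Rbar) (hc₀ : 0 < c₀) (hM₁ : 0 < M₁)
    (hM₂ : 0 ≤ M₂) (hA : UniformlyElliptic (domain θ₀ r₁ r₂) A c₀ M₁)
    (hb : ∀ x ∈ domain θ₀ r₁ r₂, ‖b x‖ ≤ M₂) :
    ∃ ν > 0, ∃ θ₁ ≥ θ₀, ∀ u, IsSubsolution θ₀ r₁ r₂ A b u → ∀ T m₁ m₂, 0 < m₁ → 0 ≤ m₂ →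
      (∀ r, r₁ θ₁ ≤ r → r ≤ r₂ θ₁ → u (polar r θ₁) ≤ m₁) →
      (∀ r, r₁ T ≤ r → r ≤ r₂ T → u (polar r T) ≤ m₂) →
      ∀ r t, θ₁ ≤ t → t ≤ T → r₁ t ≤ r → r ≤ r₂ t →
        u (polar r t) ≤ 2 * m₁ * Real.exp (-ν * (t - θ₁)) + 2 * m₂ * Real.exp (ν * (t - T)) := by
  have hrs := h.rs_pos
  have hR : 0 < Rbar := hrs.trans_le h.rs_le_Rbar
  set C := M₁ * (2 / rs ^ 2 + 8) + M₂ * (1 / rs + 4 * Rbar)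
  have hC : 0 ≤ C := by positivity
  -- The bound 1/2 keeps 1 - σ² above 1/2; the other one makes the errors smaller than the gain,
  -- with `C + 1` giving a strict inequality.
  set ν := min (1 / 2) (8 * c₀ * rs ^ 2 / (C + 1))
  have hν : 0 < ν := by positivity
  have hν1 : ν ≤ 1 / 2 := min_le_left _ _
  have hsmall : ν * C < 8 * c₀ * rs ^ 2 := by
    have h1 : ν * (C + 1) ≤ 8 * c₀ * rs ^ 2 :=
      (le_div_iff₀ (by positivity)).1 (min_le_right _ _)
    linarith
  -- One number ν serves both as the rate and as the thinness σ ≤ ν required beyond θ₁.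
  have hlim : ∀ᶠ θ in atTop, r₂ θ ^ 2 < rs ^ 2 + ν :=
    (h.lim₂.pow 2).eventually_lt_const (by linarith)
  obtain ⟨N, hN⟩ := eventually_atTop.1 hlim
  refine ⟨ν, hν, max N θ₀, le_max_right _ _, ?_⟩
  set θ₁ := max N θ₀
  have hθ₁ : θ₀ ≤ θ₁ := le_max_right _ _
  intro u hu T m₁ m₂ hm₁ hm₂ hleft hright r t ht₁ ht₂ hr₁ hr₂
  have hthin : ∀ {ρ θ : ℝ}, θ₁ ≤ θ → r₁ θ ≤ ρ → ρ ≤ r₂ θ →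
      rs ≤ ρ ∧ ρ ≤ Rbar ∧ 0 ≤ ρ ^ 2 - rs ^ 2 ∧ ρ ^ 2 - rs ^ 2 ≤ ν := by
    intro ρ θ hθ h1 h2
    have h3 : rs ≤ ρ := (h.rs_le (hθ₁.trans hθ)).trans h1
    have h4 : ρ ^ 2 ≤ r₂ θ ^ 2 := pow_le_pow_left₀ (hrs.le.trans h3) h2 2
    have h5 := hN θ ((le_max_left _ _).trans hθ)
    have h6 : rs ^ 2 ≤ ρ ^ 2 := pow_le_pow_left₀ hrs.le h3 2
    exact ⟨h3, h2.trans (h.bound _ (hθ₁.trans hθ)), by linarith, by linarith⟩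
  have hφ : ∀ {ρ θ : ℝ}, θ₁ ≤ θ → r₁ θ ≤ ρ → ρ ≤ r₂ θ →
      1 / 2 ≤ 1 - (ρ ^ 2 - rs ^ 2) ^ 2 ∧ 1 - (ρ ^ 2 - rs ^ 2) ^ 2 ≤ 1 := by
    intro ρ θ hθ h1 h2
    obtain ⟨-, -, h3, h4⟩ := hthin hθ h1 h2
    constructor <;> nlinarith
  -- The factors 2 make up for 1 - σ² ≥ 1/2 at the two ends.
  set F : ℝ → ℝ := fun τ => 2 * m₁ * Real.exp (-ν * (τ - θ₁)) + 2 * m₂ * Real.exp (ν * (τ - T))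
  set F' : ℝ → ℝ := fun τ => 2 * m₁ * (Real.exp (-ν * (τ - θ₁)) * -ν)
    + 2 * m₂ * (Real.exp (ν * (τ - T)) * ν)
  have hexp : ∀ k c τ : ℝ, HasDerivAt (fun τ => Real.exp (k * (τ - c)))
      (Real.exp (k * (τ - c)) * k) τ := fun k c τ => by
    simpa using (((hasDerivAt_id τ).sub_const c).const_mul k).exp
  have hF : ∀ τ, HasDerivAt F (F' τ) τ := fun τ =>
    ((hexp (-ν) θ₁ τ).const_mul (2 * m₁)).fun_add ((hexp ν T τ).const_mul (2 * m₂))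
  have hF' : ∀ τ, HasDerivAt F' (ν ^ 2 * F τ) τ := fun τ =>
    ((((hexp (-ν) θ₁ τ).mul_const (-ν)).const_mul (2 * m₁)).fun_add
      (((hexp ν T τ).mul_const ν).const_mul (2 * m₂))).congr_deriv (by simp only [F]; ring)
  have hFpos : ∀ τ, 0 < F τ := fun τ => by positivity
  have hFF' : ∀ τ, |F' τ| ≤ ν * F τ := fun τ => by
    have h1 : 0 ≤ ν * (2 * m₁ * Real.exp (-ν * (τ - θ₁))) := by positivity
    have h2 : 0 ≤ ν * (2 * m₂ * Real.exp (ν * (τ - T))) := by positivity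
    rw [abs_le]
    constructor <;> simp only [F, F'] <;> linarith
  have hV0 : ∀ {ρ θ : ℝ}, θ₁ ≤ θ → r₁ θ ≤ ρ → ρ ≤ r₂ θ →
      F θ * (1 / 2) ≤ F θ * (1 - (ρ ^ 2 - rs ^ 2) ^ 2) := fun hθ h1 h2 =>
    mul_le_mul_of_nonneg_left (hφ hθ h1 h2).1 (hFpos _).le
  have hT : θ₁ ≤ T := ht₁.trans ht₂
  have hcont : Continuous F := continuous_iff_continuousAt.2 fun τ => (hF τ).continuousAt
  have hcomp := h.le_of_barrier hu.smooth hu.cont hu.op hθ₁ (T := T)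
    (V := fun r t => F t * (1 - (r ^ 2 - rs ^ 2) ^ 2)) (by fun_prop)
    (fun ρ θ h1 _ h3 h4 => by
      have hx : polar ρ θ ∈ domain θ₀ r₁ r₂ := ⟨ρ, θ, hθ₁.trans_lt h1, h3, h4, rfl⟩
      obtain ⟨h5, h6, -, h7⟩ := hthin h1.le h3.le h4.le
      exact isStrictBarrierAt_mul (hrs.trans_le h5) hc₀ (hA _ hx).1 (hA _ hx).2.1 (hA _ hx).2.2
        (hb _ hx) hM₂ hrs h5 h6 hν hν1 h7 hsmall hF hF' hFpos hFF')
    (fun ρ h1 h2 => by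
      refine (hleft ρ h1 h2).trans (le_trans ?_ (hV0 le_rfl h1 h2))
      have : 0 ≤ m₂ * Real.exp (ν * (θ₁ - T)) := by positivity
      simp only [F, sub_self, mul_zero, Real.exp_zero]
      linarith)
    (fun ρ h1 h2 => by
      refine (hright ρ h1 h2).trans (le_trans ?_ (hV0 hT h1 h2))
      have : 0 ≤ m₁ * Real.exp (-ν * (T - θ₁)) := by positivity
      simp only [F, sub_self, mul_zero, Real.exp_zero]
      linarith)
    (fun θ h1 _ => (hu.lateral₁ (hθ₁.trans h1)).trans
      (le_trans (by have := hFpos θ; linarith) (hV0 h1 le_rfl (h.lt (hθ₁.trans h1)).le)))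
    (fun θ h1 _ => (hu.lateral₂ (hθ₁.trans h1)).trans
      (le_trans (by have := hFpos θ; linarith) (hV0 h1 (h.lt (hθ₁.trans h1)).le le_rfl)))
    ht₁ ht₂ hr₁ hr₂
  exact hcomp.trans (mul_le_of_le_one_right (hFpos t).le (hφ ht₁ hr₁ hr₂).2)

/-- A subsolution that grows slowly along a sequence of cross-sections decays exponentially. -/
theorem IsSpiral.exists_decay_of_slow (h : IsSpiral θ₀ r₁ r₂ rs Rbar) (hc₀ : 0 < c₀)
    (hM₁ : 0 < M₁) (hM₂ : 0 ≤ M₂) (hA : UniformlyElliptic (domain θ₀ r₁ r₂) A c₀ M₁)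
    (hb : ∀ x ∈ domain θ₀ r₁ r₂, ‖b x‖ ≤ M₂) :
    ∃ ν > 0, ∃ θ₁ ≥ θ₀, ∀ u, IsSubsolution θ₀ r₁ r₂ A b u →
      (∀ c > 0, ∀ N, ∃ T ≥ N, ∀ r, r₁ T ≤ r → r ≤ r₂ T → u (polar r T) ≤ c * Real.exp (ν * T)) →
      ∀ S ≥ 0, (∀ r, r₁ θ₀ ≤ r → r ≤ r₂ θ₀ → u (polar r θ₀) ≤ S) →
      ∀ r t, θ₀ ≤ t → r₁ t ≤ r → r ≤ r₂ t →
        u (polar r t) ≤ S ∧ u (polar r t) ≤ 2 * S * Real.exp (-ν * (t - θ₁)) := by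
  obtain ⟨ν, hν, θ₁, hθ₁, hdec⟩ := h.exists_decay hc₀ hM₁ hM₂ hA hb
  refine ⟨ν, hν, θ₁, hθ₁, fun u hu hslow S hS hS₀ => ?_⟩
  have step : ∀ m > 0, (∀ r, r₁ θ₁ ≤ r → r ≤ r₂ θ₁ → u (polar r θ₁) ≤ m) →
      ∀ r t, θ₁ ≤ t → r₁ t ≤ r → r ≤ r₂ t →
        u (polar r t) ≤ 2 * m * Real.exp (-ν * (t - θ₁)) := by
    intro m hm hm₁ r t ht h1 h2
    refine le_of_forall_pos_le_add fun δ hδ => ?_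
    -- With this c the second term 2 c exp(νT) exp(ν(t - T)) equals δ, whatever T is.
    set c := δ / (2 * Real.exp (ν * t))
    have hc : 0 < c := by positivity
    obtain ⟨T, hT, hT'⟩ := hslow c hc t
    refine (hdec u hu T m (c * Real.exp (ν * T)) hm (by positivity) hm₁ hT' r t ht hT h1
      h2).trans_eq ?_
    congr 1
    have e : Real.exp (ν * (t - T)) * Real.exp (ν * T) = Real.exp (ν * t) := by
      rw [← Real.exp_add]; congr 1; ring
    calc _ = 2 * c * (Real.exp (ν * (t - T)) * Real.exp (ν * T)) := by ring
      _ = δ := by rw [e]; simp only [c]; field_simp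
  -- A crude bound on [θ₀, θ₁] already gives a decaying upper bound on far sections; the maximum
  -- principle then replaces it by `S`, after which the decay estimate is applied again.
  obtain ⟨m, hm, hbd⟩ := h.exists_bound hu.cont θ₁
  have hmax : ∀ r t, θ₀ ≤ t → r₁ t ≤ r → r ≤ r₂ t → u (polar r t) ≤ S := by
    intro r t ht h1 h2
    refine le_of_forall_pos_le_add fun δ hδ => ?_
    have hlim : Tendsto (fun T => 2 * m * Real.exp (-ν * (T - θ₁))) atTop (𝓝 0) := by
      have h3 : Tendsto (fun T : ℝ => ν * (T - θ₁)) atTop atTop :=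
        (tendsto_atTop_add_const_right _ (-θ₁) tendsto_id).const_mul_atTop hν
      simpa [neg_mul] using (Real.tendsto_exp_neg_atTop_nhds_zero.comp h3).const_mul (2 * m)
    obtain ⟨N, hN⟩ := eventually_atTop.1 (hlim.eventually_lt_const hδ)
    set T := max N (max t θ₁)
    have hTt : t ≤ T := (le_max_left _ _).trans (le_max_right _ _)
    have hT1 : θ₁ ≤ T := (le_max_right _ _).trans (le_max_right _ _)
    refine hu.le_of_le_ends h hc₀ hM₂ hA hb (T := T) (by positivity)
      (fun ρ h3 h4 => (hS₀ ρ h3 h4).trans (by linarith)) (fun ρ h3 h4 => ?_) ht hTt h1 h2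
    have h5 := step m hm (fun ρ h3 h4 => hbd ρ θ₁ hθ₁ le_rfl h3 h4) ρ T hT1 h3 h4
    have h6 := hN T (le_max_left _ _)
    linarith
  intro r t ht h1 h2
  refine ⟨hmax r t ht h1 h2, ?_⟩
  rcases le_total θ₁ t with h3 | h3
  -- `step` needs a positive bound while `S` may vanish, hence the limit δ → 0.
  · have hlim : Tendsto (fun δ => 2 * (S + δ) * Real.exp (-ν * (t - θ₁))) (𝓝[>] 0)
        (𝓝 (2 * S * Real.exp (-ν * (t - θ₁)))) := by
      have hc : Continuous fun δ : ℝ => 2 * (S + δ) * Real.exp (-ν * (t - θ₁)) := by fun_prop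
      simpa using (hc.tendsto 0).mono_left nhdsWithin_le_nhds
    refine ge_of_tendsto hlim (eventually_nhdsWithin_of_forall fun δ hδ => ?_)
    have hδ' : (0 : ℝ) < δ := hδ
    exact step (S + δ) (by positivity)
      (fun ρ h4 h5 => (hmax ρ θ₁ hθ₁ h4 h5).trans (by linarith)) r t h3 h1 h2
  · have h4 : 1 ≤ Real.exp (-ν * (t - θ₁)) := Real.one_le_exp (by nlinarith)
    have h5 := hmax r t ht h1 h2
    nlinarith

/-- The lower bound rs (θ - θ₀) ≤ ℒ confines a band to a compact range of angles. Boundedness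
matters because `sSup` of an unbounded set of reals is 0. -/
theorem IsSpiral.bddAbove_arcBand (h : IsSpiral θ₀ r₁ r₂ rs Rbar) {Θ : ℝ} (hΘ : θ₀ ≤ Θ)
    (hreg₁ : RegularBoundary θ₀ Θ r₁) (hreg₂ : RegularBoundary θ₀ Θ r₂)
    (hv : ContinuousOn v (domainTilde θ₀ r₁ r₂)) (a c : ℝ) :
    BddAbove (v '' arcBand θ₀ r₁ r₂ (Icc a c)) := by
  obtain ⟨m, -, hm⟩ := h.exists_bound hv (c / rs + θ₀)
  refine ⟨m, ?_⟩
  rintro _ ⟨_, ⟨⟨r, t, ht, h1, h2, rfl⟩, hJ⟩, rfl⟩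
  refine hm r t ht ?_ h1 h2
  have h3 := (h.arcDist_bounds hΘ hreg₁ hreg₂ ht h1 h2).1.trans hJ.2
  rw [← sub_le_iff_le_add, le_div_iff₀ h.rs_pos]
  linarith

/-- Exponential growth over cross-sections gives exponential growth over arc-distance bands. -/
theorem IsSpiral.growth_arcBand (h : IsSpiral θ₀ r₁ r₂ rs Rbar) {Θ : ℝ} (hΘ : θ₀ ≤ Θ)
    (hreg₁ : RegularBoundary θ₀ Θ r₁) (hreg₂ : RegularBoundary θ₀ Θ r₂)
    (hv : ContinuousOn v (domainTilde θ₀ r₁ r₂)) {ν c N : ℝ} (hν : 0 < ν) (hc : 0 < c)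
    (hgrow : ∀ T ≥ N, ∃ r, r₁ T ≤ r ∧ r ≤ r₂ T ∧ c * Real.exp (ν * T) ≤ v (polar r T)) :
    ∃ C > (0 : ℝ), ∀ ε > (0 : ℝ), ∃ ℓ₁ ≥ (0 : ℝ), ∀ ℓ ≥ ℓ₁,
      C * Real.exp (ν / (Rbar + mu0 r₁ r₂ Θ) * ℓ) ≤ sSup (v '' arcBand θ₀ r₁ r₂
        (Icc ((kStar r₁ r₂ rs Rbar Θ + ε)⁻¹ * ℓ) ((kStar r₁ r₂ rs Rbar Θ + ε) * ℓ))) := by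
  have hrs := h.rs_pos
  have hmu : 0 ≤ mu0 r₁ r₂ Θ := (derivSupNorm_nonneg r₁ Θ).trans (le_max_left _ _)
  have hκ : rs ≤ Rbar + mu0 r₁ r₂ Θ := by linarith [h.rs_le_Rbar]
  have hk : 1 ≤ kStar r₁ r₂ rs Rbar Θ := (one_le_div hrs).2 hκ
  set D := ∫ η in Ioc θ₀ Θ, (|deriv r₁ η| + |deriv r₂ η|)
  -- The threshold D / ε lets ε ℓ absorb the additive constant D of the arc-distance bound; the
  -- other one puts the chosen section beyond N.
  refine ⟨c * Real.exp (ν * θ₀), by positivity, fun ε hε =>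
    ⟨max 0 (max (D / ε) (rs * (N - θ₀))), le_max_left _ _, fun ℓ hℓ => ?_⟩⟩
  have hℓ0 : 0 ≤ ℓ := (le_max_left _ _).trans hℓ
  have hℓD : D ≤ ε * ℓ := by
    rw [mul_comm, ← div_le_iff₀ hε]
    exact ((le_max_left _ _).trans (le_max_right _ _)).trans hℓ
  have hℓN : rs * (N - θ₀) ≤ ℓ := ((le_max_right _ _).trans (le_max_right _ _)).trans hℓ
  -- Arc-distances on this section lie between ℓ and k_* ℓ + D.
  set T := θ₀ + ℓ / rs
  have hTθ : T - θ₀ = ℓ / rs := by simp [T]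
  have hT0 : θ₀ ≤ T := le_add_of_nonneg_right (by positivity)
  have hTN : N ≤ T := by
    have : N - θ₀ ≤ ℓ / rs := by rw [le_div_iff₀ hrs]; linarith
    linarith
  obtain ⟨r, h1, h2, h3⟩ := hgrow T hTN
  obtain ⟨h4, h5⟩ := h.arcDist_bounds hΘ hreg₁ hreg₂ hT0 h1 h2
  have hmem : polar r T ∈ arcBand θ₀ r₁ r₂
      (Icc ((kStar r₁ r₂ rs Rbar Θ + ε)⁻¹ * ℓ) ((kStar r₁ r₂ rs Rbar Θ + ε) * ℓ)) := by
    refine ⟨polar_mem_domainTilde hT0 h1 h2, ?_, ?_⟩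
    · have h6 : (kStar r₁ r₂ rs Rbar Θ + ε)⁻¹ ≤ 1 := inv_le_one_of_one_le₀ (by linarith)
      refine (mul_le_of_le_one_left hℓ0 h6).trans (le_trans (le_of_eq ?_) h4)
      rw [hTθ]
      field_simp
    · refine h5.trans ?_
      have h6 : (Rbar + mu0 r₁ r₂ Θ) * (T - θ₀) = kStar r₁ r₂ rs Rbar Θ * ℓ := by
        rw [hTθ, kStar]
        ring
      rw [h6]
      linarith
  refine le_trans ?_ (le_csSup (h.bddAbove_arcBand hΘ hreg₁ hreg₂ hv _ _) ⟨_, hmem, rfl⟩)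
  refine le_trans ?_ h3
  -- Growth even holds at rate ν / rs; the smaller rate is the one that decay also satisfies.
  have h7 : ν / (Rbar + mu0 r₁ r₂ Θ) * ℓ ≤ ν * (ℓ / rs) := by
    rw [div_mul_eq_mul_div, ← mul_div_assoc]
    exact div_le_div_of_nonneg_left (by positivity) hrs hκ
  rw [mul_assoc, ← Real.exp_add]
  refine mul_le_mul_of_nonneg_left (Real.exp_le_exp.2 ?_) hc.le
  simp only [T, mul_add]
  linarith

theorem IsSpiral.le_sSup_crossSection (h : IsSpiral θ₀ r₁ r₂ rs Rbar)
    (hv : ContinuousOn v (domainTilde θ₀ r₁ r₂)) {r : ℝ} (h1 : r₁ θ₀ ≤ r) (h2 : r ≤ r₂ θ₀) :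
    v (polar r θ₀) ≤ sSup (v '' crossSection r₁ r₂ θ₀) := by
  obtain ⟨m, -, hm⟩ := h.exists_bound hv θ₀
  refine le_csSup ⟨m, ?_⟩ ⟨_, ⟨r, h1, h2, rfl⟩, rfl⟩
  rintro _ ⟨_, ⟨ρ, h3, h4, rfl⟩, rfl⟩
  exact hm ρ θ₀ le_rfl le_rfl h3 h4

/-- The alternative between decay and growth, for a function `v` that dominates subsolutions. -/
theorem IsSpiral.exists_dichotomy (h : IsSpiral θ₀ r₁ r₂ rs Rbar) {Θ : ℝ} (hΘ : θ₀ ≤ Θ)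
    (hreg₁ : RegularBoundary θ₀ Θ r₁) (hreg₂ : RegularBoundary θ₀ Θ r₂) (hc₀ : 0 < c₀)
    (hM₁ : 0 < M₁) (hM₂ : 0 ≤ M₂) (hA : UniformlyElliptic (domain θ₀ r₁ r₂) A c₀ M₁)
    (hb : ∀ x ∈ domain θ₀ r₁ r₂, ‖b x‖ ≤ M₂) :
    ∃ Cs > (0 : ℝ), ∃ ν > (0 : ℝ), ∀ v : Plane → ℝ, ContinuousOn v (domainTilde θ₀ r₁ r₂) →
      (∀ x, 0 ≤ v x) →
      (∀ u, IsSubsolution θ₀ r₁ r₂ A b u → (∀ x, u x ≤ v x) → ∀ x ∈ domainTilde θ₀ r₁ r₂,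
        max (u x) 0 ≤ sSup (v '' crossSection r₁ r₂ θ₀) ∧
        max (u x) 0 ≤ Cs * sSup (v '' crossSection r₁ r₂ θ₀)
          * Real.exp (-ν * arcDist θ₀ r₁ r₂ x)) ∨
      (∃ C > (0 : ℝ), ∀ ε > (0 : ℝ), ∃ ℓ₁ ≥ (0 : ℝ), ∀ ℓ ≥ ℓ₁,
        C * Real.exp (ν * ℓ) ≤ sSup (v '' arcBand θ₀ r₁ r₂
          (Icc ((kStar r₁ r₂ rs Rbar Θ + ε)⁻¹ * ℓ) ((kStar r₁ r₂ rs Rbar Θ + ε) * ℓ)))) := by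
  obtain ⟨ν, hν, θ₁, hθ₁, hdec⟩ := h.exists_decay_of_slow hc₀ hM₁ hM₂ hA hb
  have hmu : 0 ≤ mu0 r₁ r₂ Θ := (derivSupNorm_nonneg r₁ Θ).trans (le_max_left _ _)
  set κ := Rbar + mu0 r₁ r₂ Θ
  have hκ : 0 < κ := h.rs_pos.trans_le (by simp only [κ]; linarith [h.rs_le_Rbar])
  set D := ∫ η in Ioc θ₀ Θ, (|deriv r₁ η| + |deriv r₂ η|)
  -- The constant comes from inserting t - θ₀ ≥ (ℒ - D) / κ into 2 S exp(-ν(t - θ₁)).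
  refine ⟨2 * Real.exp (ν / κ * D + ν * (θ₁ - θ₀)), by positivity, ν / κ, by positivity,
    fun v hv hv0 => ?_⟩
  by_cases hgrow : ∃ c > 0, ∃ N, ∀ T ≥ N, ∃ r, r₁ T ≤ r ∧ r ≤ r₂ T ∧
      c * Real.exp (ν * T) ≤ v (polar r T)
  · obtain ⟨c, hc, N, hN⟩ := hgrow
    exact Or.inr (h.growth_arcBand hΘ hreg₁ hreg₂ hv hν hc hN)
  -- Failure of growth gives, for each c > 0, arbitrarily far sections on which v < c exp(νT): the
  -- slow growth needed for decay.
  · push Not at hgrow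
    refine Or.inl fun u hu huv x hx => ?_
    set S := sSup (v '' crossSection r₁ r₂ θ₀)
    have hS : 0 ≤ S :=
      (hv0 _).trans (h.le_sSup_crossSection hv le_rfl (h.lt le_rfl).le)
    obtain ⟨r, t, ht, h1, h2, rfl⟩ := hx
    obtain ⟨h3, h4⟩ := hdec u hu
      (fun c hc N => by
        obtain ⟨T, hT, hT'⟩ := hgrow c hc N
        exact ⟨T, hT, fun ρ g1 g2 => (huv _).trans (hT' ρ g1 g2).le⟩)
      S hS (fun ρ g1 g2 => (huv _).trans (h.le_sSup_crossSection hv g1 g2)) r t ht h1 h2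
    refine ⟨max_le h3 hS, max_le (h4.trans ?_) (by positivity)⟩
    have h5 := (h.arcDist_bounds hΘ hreg₁ hreg₂ ht h1 h2).2
    have h6 := mul_le_mul_of_nonneg_left h5 (show 0 ≤ ν / κ by positivity)
    have h7 : ν / κ * (D + κ * (t - θ₀)) = ν / κ * D + ν * (t - θ₀) := by field_simp
    calc 2 * S * Real.exp (-ν * (t - θ₁))
        ≤ 2 * S * Real.exp (ν / κ * D + ν * (θ₁ - θ₀)
          + -(ν / κ) * arcDist θ₀ r₁ r₂ (polar r t)) := by
          refine mul_le_mul_of_nonneg_left (Real.exp_le_exp.2 ?_) (by positivity)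
          linarith
      _ = _ := by rw [Real.exp_add]; ring

theorem ellipticOp_neg (A : Plane → Matrix (Fin 2) (Fin 2) ℝ) (b : Plane → Plane)
    (u : Plane → ℝ) (x : Plane) : ellipticOp A b (fun y => -u y) x = -ellipticOp A b u x := by
  have h1 : ∀ i j, secondPartial (fun y => -u y) i j x = -secondPartial u i j x := by
    intro i j
    simp only [secondPartial, fderiv_fun_neg, neg_apply]
  have h2 : gradient (fun y => -u y) x = -gradient u x := by
    simp only [gradient, fderiv_fun_neg, map_neg]
  simp only [ellipticOp, h1, h2, inner_neg_right, mul_neg, Finset.sum_neg_distrib]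
  ring

end Spiral

end

theorem corollary4p3
    -- the domain
    (θ₀ : ℝ) (r₁ r₂ : ℝ → ℝ) (rs Rbar : ℝ)
    (hr₁_cont : ContinuousOn r₁ (Set.Ici θ₀)) (hr₂_cont : ContinuousOn r₂ (Set.Ici θ₀))
    (hr₁_pos : ∀ θ, θ₀ ≤ θ → 0 < r₁ θ) (hr₂_pos : ∀ θ, θ₀ ≤ θ → 0 < r₂ θ)
    (hspiral : ∀ θ, θ₀ ≤ θ → r₂ (θ + 2 * Real.pi) < r₁ θ ∧ r₁ θ < r₂ θ)
    (hrs : 0 < rs)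
    (hr₁_lim : Filter.Tendsto r₁ Filter.atTop (nhds rs))
    (hr₂_lim : Filter.Tendsto r₂ Filter.atTop (nhds rs))
    (hRbar : ∀ θ, θ₀ ≤ θ → r₂ θ ≤ Rbar)
    -- regularity of the boundary curves
    (Θ : ℝ) (hΘ : θ₀ ≤ Θ)
    (hr₁_reg : Spiral.RegularBoundary θ₀ Θ r₁) (hr₂_reg : Spiral.RegularBoundary θ₀ Θ r₂)
    -- the operator
    (A : Spiral.Plane → Matrix (Fin 2) (Fin 2) ℝ) (b : Spiral.Plane → Spiral.Plane)
    (c₀ M₁ M₂ : ℝ) (hc₀ : 0 < c₀) (hM₁ : 0 < M₁) (hM₂ : 0 ≤ M₂)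
    (hA : Spiral.UniformlyElliptic (Spiral.domain θ₀ r₁ r₂) A c₀ M₁)
    (hb : ∀ x ∈ Spiral.domain θ₀ r₁ r₂, ‖b x‖ ≤ M₂) :
    ∃ Cs > (0 : ℝ), ∃ ν > (0 : ℝ),
      ∀ u : Spiral.Plane → ℝ, ContDiffOn ℝ 2 u (Spiral.domain θ₀ r₁ r₂) →
        ContinuousOn u (Spiral.domainTilde θ₀ r₁ r₂) →
        -- sub-solutions
        (((∀ x ∈ Spiral.domain θ₀ r₁ r₂, Spiral.ellipticOp A b u x ≤ 0) →
          (∀ x ∈ Spiral.lateralBoundary θ₀ r₁ r₂, u x ≤ 0) →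
          ((∀ x ∈ Spiral.domainTilde θ₀ r₁ r₂,
              (u x)⁺ ≤ sSup ((fun y => (u y)⁺) '' Spiral.crossSection r₁ r₂ θ₀)) ∧
            (∀ x ∈ Spiral.domainTilde θ₀ r₁ r₂,
              (u x)⁺ ≤ Cs * sSup ((fun y => (u y)⁺) '' Spiral.crossSection r₁ r₂ θ₀) *
                Real.exp (-ν * Spiral.arcDist θ₀ r₁ r₂ x))) ∨
          (∃ C₁ > (0 : ℝ), ∀ ε > (0 : ℝ), ∃ ℓ₁ ≥ (0 : ℝ), ∀ ℓ ≥ ℓ₁,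
            C₁ * Real.exp (ν * ℓ) ≤
              sSup ((fun y => (u y)⁺) '' Spiral.arcBand θ₀ r₁ r₂
                (Set.Icc ((Spiral.kStar r₁ r₂ rs Rbar Θ + ε)⁻¹ * ℓ)
                  ((Spiral.kStar r₁ r₂ rs Rbar Θ + ε) * ℓ))))) ∧
        -- solutions
        ((∀ x ∈ Spiral.domain θ₀ r₁ r₂, Spiral.ellipticOp A b u x = 0) →
          (∀ x ∈ Spiral.lateralBoundary θ₀ r₁ r₂, u x = 0) →
          ((∀ x ∈ Spiral.domainTilde θ₀ r₁ r₂,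
              |u x| ≤ sSup ((fun y => |u y|) '' Spiral.crossSection r₁ r₂ θ₀)) ∧
            (∀ x ∈ Spiral.domainTilde θ₀ r₁ r₂,
              |u x| ≤ Cs * sSup ((fun y => |u y|) '' Spiral.crossSection r₁ r₂ θ₀) *
                Real.exp (-ν * Spiral.arcDist θ₀ r₁ r₂ x))) ∨
          (∃ C > (0 : ℝ), ∀ ε > (0 : ℝ), ∃ ℓ₁ ≥ (0 : ℝ), ∀ ℓ ≥ ℓ₁,
            C * Real.exp (ν * ℓ) ≤
              sSup ((fun y => |u y|) '' Spiral.arcBand θ₀ r₁ r₂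
                (Set.Icc ((Spiral.kStar r₁ r₂ rs Rbar Θ + ε)⁻¹ * ℓ)
                  ((Spiral.kStar r₁ r₂ rs Rbar Θ + ε) * ℓ)))))) := by

  have h : Spiral.IsSpiral θ₀ r₁ r₂ rs Rbar :=
    ⟨hr₁_cont, hr₂_cont, hspiral, hrs, hr₁_lim, hr₂_lim, hRbar⟩
  obtain ⟨Cs, hCs, ν, hν, hdich⟩ := h.exists_dichotomy hΘ hr₁_reg hr₂_reg hc₀ hM₁ hM₂ hA hb
  refine ⟨Cs, hCs, ν, hν, fun u hu huc => ⟨fun hL hlat => ?_, fun hL hlat => ?_⟩⟩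
  · rcases hdich (fun y => (u y)⁺) (huc.sup continuousOn_const) (fun x => posPart_nonneg _)
      with hd | hd
    · have hs := hd u ⟨hu, huc, hL, hlat⟩ fun x => le_posPart _
      exact Or.inl ⟨fun x hx => (hs x hx).1, fun x hx => (hs x hx).2⟩
    · exact Or.inr hd
  -- A single alternative for |u| governs both u and -u, each a subsolution dominated by |u|.
  · rcases hdich (fun y => |u y|) huc.abs (fun x => abs_nonneg _) with hd | hd
    · have hs := hd u ⟨hu, huc, fun x hx => (hL x hx).le, fun x hx => (hlat x hx).le⟩
        fun x => le_abs_self _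
      have hn := hd (fun y => -u y) ⟨hu.neg, huc.neg,
        fun x hx => by rw [Spiral.ellipticOp_neg, hL x hx, neg_zero],
        fun x hx => by rw [hlat x hx, neg_zero]⟩ fun x => neg_le_abs _
      exact Or.inl ⟨fun x hx => abs_le'.2 ⟨(le_max_left _ _).trans (hs x hx).1,
          (le_max_left _ _).trans (hn x hx).1⟩,
        fun x hx => abs_le'.2 ⟨(le_max_left _ _).trans (hs x hx).2,
          (le_max_left _ _).trans (hn x hx).2⟩⟩
    · exact Or.inr hd
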